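/- Let $d\ge 1$, let $a\ge 0$ be a function in $L^1(\mathbb{R}^d)$, and put $a^{(0)}=\int a$. The one-particle jump process started at $x$ is $X_s=Y_{Z_s}$, where $Z$ is a Poisson process of rate $a^{(0)}$ and $Y$ is an independent Markov chain with $Y_0=x$ and transition density $a(x-y)/a^{(0)}$ from $x$ to $y$ (if $a^{(0)}=0$ the particle does not move). Let $\Gamma$ be the space of locally finite subsets of $\mathbb{R}^d$ with the Borel $\sigma$-algebra of the vague topology, write $\langle f,\gamma\rangle=\sum_{x\in\gamma}f(x)$, and let $\Theta\subset\Gamma$ be the set of those $\gamma$ for which there is $m\in\mathbb N$ with $|\gamma\cap B(n)|\le m\,\mathrm{vol}(B(n))$ for all $n\ge1$, $B(n)$ being the closed ball of radius $n$ about $0$. For $\gamma\in\Gamma$ let $\mathbf{X}$ be the process started at $\gamma$ in which all the points of $\gamma$ move as independent copies of the one-particle process, with expectation $\mathbf{E}_\gamma$. For locally integrable $z\ge 0$ let $\pi_z$ be the Poisson measure on $\Gamma$ with intensity $z$, i.e. the probability measure with $\int e^{\langle\varphi,\gamma\rangle}\,\pi_z(d\gamma)=\exp\int(e^{\varphi}-1)z\,dx$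 for all real $\varphi\in C_c^\infty(\mathbb{R}^d)$. Put $\hat f(k)=(2\pi)^{-d/2}\int e^{-i\langle x,k\rangle}f(x)\,dx$. Let $z\ge 0$ be a bounded measurable function whose Fourier transform, as a tempered distribution, is a (possibly complex-valued, not necessarily finite) signed measure with respect to whose total variation all Schwartz functions are integrable. For $\kappa\in\{1,2\}$, $\varepsilon>0$ and $t\ge0$ let $$n_t^{(\varepsilon)}(\varphi,\mathbf{X})=\varepsilon^d\langle\varphi(\varepsilon\,\cdot),\mathbf{X}_{\varepsilon^{-\kappa}t}\rangle .$$ Then in each of the following two cases, for every $t\ge0$, there is a distribution $\rho_t\in\mathcal D'(\mathbb{R}^d)$, given by the formula stated there for all real $\varphi\in C_c^\infty(\mathbb{R}^d)$, such that for every real $\varphi\in C_c^\infty(\mathbb{R}^d)$ the integrals below converge for all $\varepsilon>0$ (the inner one for $\pi_{z(\varepsilon\cdot)}$-almost every $\gamma\in\Theta$) and $$\lim_{\varepsilon\to0^+}\int_\Theta \pi_{z(\varepsilon\,\cdot)}(d\gamma)\,\mathbf{E}_\gamma\!\left[e^{n_t^{(\varepsilon)}(\varphi,\mathbf{X})}\right]=e^{\langle\varphi,\rho_t\rangle}.$$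 1. If all first moments $a^{(1)}_i=\int x_i a(x)\,dx$ are finite (absolutely convergent), $a^{(1)}=(a^{(1)}_1,\dots,a^{(1)}_d)\ne0$ and $\kappa=1$, then $\langle\varphi,\rho_t\rangle=\int z(x+ta^{(1)})\varphi(x)\,dx$. 2. If all second moments $a^{(2)}_{ij}=\int x_ix_ja(x)\,dx$ are finite (absolutely convergent), $a^{(1)}=0$ and $\kappa=2$, then, with the matrix $a^{(2)}=(a^{(2)}_{ij})$, $$\langle\varphi,\rho_t\rangle=\frac1{(2\pi)^{d/2}}\int dx\,z(x)\int dk\,e^{i\langle k,x\rangle}e^{-\frac t2\langle a^{(2)}k,k\rangle}\hat\varphi(k).$$ -/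

import Mathlib

open MeasureTheory Filter Topology
open scoped CompactlySupported Distributions SchwartzMap

noncomputable section

namespace FreeKawasaki

/-- The Euclidean space `ℝ^d`. -/
abbrev Space (d : ℕ) : Type := EuclideanSpace ℝ (Fin d)

/-! ### Configurations -/

/-- A set of points is locally finite if every compact set contains finitely many of them. -/
def LocFinite {d : ℕ} (s : Set (Space d)) : Prop :=
  ∀ K : Set (Space d), IsCompact K → (s ∩ K).Finite

/-- The configuration space `Γ` of all locally finite subsets of `ℝ^d`. -/
structure Configuration (d : ℕ) where
  /-- the set of points -/
  points : Set (Space d)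
  locFinite : LocFinite points

lemma locFinite_empty {d : ℕ} : LocFinite (∅ : Set (Space d)) := fun K _ => by simp

/-- The pairing `⟨f, γ⟩ = ∑_{x ∈ γ} f x`. -/
def pairing {d : ℕ} (f : Space d → ℝ) (γ : Configuration d) : ℝ := ∑' x : γ.1, f x

/-- The vague topology: the weakest topology for which all `γ ↦ ⟨f, γ⟩`, `f ∈ C_c(ℝ^d)`,
are continuous. -/
instance vagueTopology (d : ℕ) : TopologicalSpace (Configuration d) :=
  TopologicalSpace.induced (fun γ (f : C_c(Space d, ℝ)) => pairing f γ) inferInstance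

instance (d : ℕ) : MeasurableSpace (Configuration d) := borel _

instance (d : ℕ) : BorelSpace (Configuration d) := ⟨rfl⟩

/-- The set `Θ` of the admissible initial configurations: for some `m`, every closed ball `B(n)`,
`n = 1, 2, …`, centered at the origin contains at most `m vol(B(n))` points. -/
def admissible (d : ℕ) : Set (Configuration d) :=
  {γ | ∃ m : ℕ, ∀ n : ℕ, 1 ≤ n →
    ((γ.1 ∩ Metric.closedBall 0 (n : ℝ)).ncard : ℝ)
      ≤ m * volume.real (Metric.closedBall (0 : Space d) (n : ℝ))}

/-! ### Poisson measures -/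

/-- `π` is the Poisson measure on `Γ` with intensity `z`: it is the probability measure with
Laplace transform `exp (∫ (e^φ - 1) z)`, `φ ∈ 𝓓(ℝ^d)`. -/
structure IsPoisson {d : ℕ} (z : Space d → ℝ) (π : Measure (Configuration d)) : Prop where
  isProbabilityMeasure : IsProbabilityMeasure π
  laplace : ∀ φ : 𝓓((⊤ : TopologicalSpace.Opens (Space d)), ℝ),
    ∫ γ, Real.exp (pairing φ γ) ∂π = Real.exp (∫ x, (Real.exp (φ x) - 1) * z x)

/-! The remainder of this section shows that Poisson measures exist. -/

lemma pairing_eq_sum {d : ℕ} {f : Space d → ℝ} {K : Set (Space d)} (hK : IsCompact K)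
    (hf : ∀ x, x ∉ K → f x = 0) (γ : Configuration d) :
    pairing f γ = ∑ x ∈ (γ.2 K hK).toFinset, f x := by
  unfold pairing
  rw [tsum_subtype γ.1 f, tsum_eq_sum (s := (γ.2 K hK).toFinset)]
  · refine Finset.sum_congr rfl fun x hx => ?_
    rw [Set.Finite.mem_toFinset] at hx
    exact Set.indicator_of_mem hx.1 f
  · intro x hx
    rw [Set.Finite.mem_toFinset] at hx
    by_cases hxγ : x ∈ γ.1
    · rw [Set.indicator_of_mem hxγ]
      exact hf x fun hxK => hx ⟨hxγ, hxK⟩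
    · exact Set.indicator_of_notMem hxγ f

lemma continuous_pairing {d : ℕ} (f : C_c(Space d, ℝ)) :
    Continuous fun γ : Configuration d => pairing f γ :=
  (continuous_apply f).comp
    (continuous_induced_dom (f := fun (γ : Configuration d) (f : C_c(Space d, ℝ)) => pairing f γ))

/-- The compactly supported continuous function `max 0 (n + 1 - |x|)`. -/
def bump (d n : ℕ) : C_c(Space d, ℝ) where
  toFun x := max 0 (n + 1 - ‖x‖)
  continuous_toFun := by fun_prop
  hasCompactSupport' := by
    refine HasCompactSupport.intro (isCompact_closedBall (0 : Space d) (n + 1)) fun x hx => ?_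
    rw [mem_closedBall_zero_iff, not_le] at hx
    exact max_eq_left (by linarith)

lemma bump_apply (d n : ℕ) (x : Space d) : bump d n x = max 0 (n + 1 - ‖x‖) := rfl

/-- Two functions supported in a ball that are uniformly close have close pairings. -/
lemma abs_pairing_sub_le {d n : ℕ} {f g : Space d → ℝ} {δ : ℝ}
    (hf : ∀ x, x ∉ Metric.closedBall (0 : Space d) n → f x = 0)
    (hg : ∀ x, x ∉ Metric.closedBall (0 : Space d) n → g x = 0)
    (h : ∀ x ∈ Metric.closedBall (0 : Space d) n, |f x - g x| ≤ δ) (γ : Configuration d) :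
    |pairing f γ - pairing g γ| ≤ δ * pairing (bump d n) γ := by
  have hK := isCompact_closedBall (0 : Space d) (n : ℝ)
  have hK' := isCompact_closedBall (0 : Space d) ((n : ℝ) + 1)
  have h1 : ((γ.2 _ hK).toFinset.card : ℝ) ≤ pairing (bump d n) γ := by
    rw [pairing_eq_sum hK' (fun x hx => ?_) γ]
    · calc ((γ.2 _ hK).toFinset.card : ℝ) = ∑ x ∈ (γ.2 _ hK).toFinset, (1 : ℝ) := by simp
        _ ≤ ∑ x ∈ (γ.2 _ hK).toFinset, bump d n x := by
            refine Finset.sum_le_sum fun x hx => ?_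
            rw [Set.Finite.mem_toFinset] at hx
            have := mem_closedBall_zero_iff.1 hx.2
            rw [bump_apply]
            exact le_max_of_le_right (by linarith)
        _ ≤ ∑ x ∈ (γ.2 _ hK').toFinset, bump d n x := by
            refine Finset.sum_le_sum_of_subset_of_nonneg (fun x hx => ?_) fun x _ _ => ?_
            · rw [Set.Finite.mem_toFinset] at hx ⊢
              exact ⟨hx.1, Metric.closedBall_subset_closedBall (by linarith) hx.2⟩
            · rw [bump_apply]; exact le_max_left _ _
    · rw [mem_closedBall_zero_iff, not_le] at hx
      rw [bump_apply]
      exact max_eq_left (by linarith)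
  rw [pairing_eq_sum hK hf, pairing_eq_sum hK hg, ← Finset.sum_sub_distrib]
  have h2 : |∑ x ∈ (γ.2 _ hK).toFinset, (f x - g x)| ≤ (γ.2 _ hK).toFinset.card * δ := by
    refine (Finset.abs_sum_le_sum_abs _ _).trans ?_
    rw [← nsmul_eq_mul]
    refine Finset.sum_le_card_nsmul _ _ _ fun x hx => h x ?_
    rw [Set.Finite.mem_toFinset] at hx
    exact hx.2
  rcases (γ.2 _ hK).toFinset.eq_empty_or_nonempty with he | ⟨x, hx⟩
  · rw [he, Finset.sum_empty, abs_zero]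
    have hδ : 0 ≤ δ := (abs_nonneg _).trans (h 0 (by simp))
    have : 0 ≤ pairing (bump d n) γ := le_trans (by positivity) h1
    positivity
  · rw [Set.Finite.mem_toFinset] at hx
    have hδ : 0 ≤ δ := (abs_nonneg _).trans (h x hx.2)
    nlinarith

/-- A map into the configuration space is measurable if all `⟨f, ·⟩`, `f ∈ C_c(ℝ^d)`, are
measurable along it. -/
lemma measurable_of_pairing {d : ℕ} {Ω : Type*} [MeasurableSpace Ω] {g : Ω → Configuration d}
    (hg : ∀ f : C_c(Space d, ℝ), Measurable fun ω => pairing f (g ω)) : Measurable g := by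
  let A : ℕ → Set C(Space d, ℝ) := fun n =>
    {f | ∀ x, x ∉ Metric.closedBall (0 : Space d) n → f x = 0}
  choose D hDc hDd using fun n => TopologicalSpace.exists_countable_dense (A n)
  have hAcpt : ∀ n (f : A n), HasCompactSupport f.1 := fun n f =>
    HasCompactSupport.intro (isCompact_closedBall (0 : Space d) (n : ℝ)) f.2
  let F : (Σ n, D n) ⊕ ℕ → C_c(Space d, ℝ) :=
    Sum.elim (fun p => ⟨p.2.1.1, hAcpt p.1 p.2.1⟩) (fun n => bump d n)
  have : ∀ n, Countable (D n) := fun n => (hDc n).to_subtype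
  let G : Configuration d → ((Σ n, D n) ⊕ ℕ → ℝ) := fun γ j => pairing (F j) γ
  let tD : TopologicalSpace (Configuration d) := TopologicalSpace.induced G inferInstance
  have hFc : ∀ j, @Continuous _ _ tD _ fun γ => pairing (F j) γ := fun j =>
    (continuous_apply j).comp (@continuous_induced_dom _ _ G _)
  have hle : tD ≤ vagueTopology d := by
    refine (continuous_iff_le_induced
      (f := fun (γ : Configuration d) (f : C_c(Space d, ℝ)) => pairing f γ)).1 ?_
    refine continuous_pi fun f => ?_
    obtain ⟨n, hn⟩ : ∃ n : ℕ, ∀ x, x ∉ Metric.closedBall (0 : Space d) n → f x = 0 := by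
      obtain ⟨R, hR⟩ := f.hasCompactSupport'.isCompact.isBounded.subset_closedBall 0
      obtain ⟨n, hn⟩ := exists_nat_ge R
      refine ⟨n, fun x hx => ?_⟩
      by_contra hne
      exact hx (Metric.closedBall_subset_closedBall hn (hR (subset_tsupport _ hne)))
    let := tD
    refine continuous_of_locally_uniform_approx_of_continuousAt fun γ₀ u hu => ?_
    obtain ⟨ε, hε, hεu⟩ := Metric.mem_uniformity_dist.1 hu
    set B : ℝ := |pairing (bump d n) γ₀| + 1 with hB
    have hBpos : 0 < B := by positivity
    have hδ : 0 < ε / (2 * B) := by positivity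
    obtain ⟨q, hqD, hq⟩ : ∃ q ∈ D n, ∀ x ∈ Metric.closedBall (0 : Space d) (n : ℝ),
        dist (f x) (q.1 x) < ε / (2 * B) := by
      let f' : A n := ⟨f.toContinuousMap, hn⟩
      have hcl : f' ∈ closure (D n) := hDd n f'
      obtain ⟨q, hqD, hq⟩ := mem_closure_iff_nhds.1 hcl
        {q | ∀ x ∈ Metric.closedBall (0 : Space d) (n : ℝ),
          dist (f x) (q.1 x) < ε / (2 * B)} (by
          have hval : Tendsto (fun q : A n => q.1) (𝓝 f') (𝓝 f'.1) :=
            continuous_subtype_val.tendsto f'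
          have := ContinuousMap.tendsto_iff_forall_isCompact_tendstoUniformlyOn.1 hval _
            (isCompact_closedBall (0 : Space d) (n : ℝ))
          exact Metric.tendstoUniformlyOn_iff.1 this _ hδ)
      exact ⟨q, hq, hqD⟩
    refine ⟨{γ | pairing (bump d n) γ < B}, ?_, fun γ => pairing (F (.inl ⟨n, q, hqD⟩)) γ,
      (hFc _).continuousAt, fun γ hγ => hεu ?_⟩
    · have hc : Continuous fun γ : Configuration d => pairing (bump d n) γ := hFc (.inr n)
      refine (isOpen_lt hc continuous_const).mem_nhds ?_
      show pairing (bump d n) γ₀ < B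
      have := le_abs_self (pairing (bump d n) γ₀)
      linarith
    · rw [Real.dist_eq]
      have h1 := abs_pairing_sub_le (f := f) (g := q.1) (δ := ε / (2 * B)) hn q.2
        (fun x hx => (hq x hx).le) γ
      have h2 : ε / (2 * B) * pairing (bump d n) γ ≤ ε / (2 * B) * B :=
        mul_le_mul_of_nonneg_left (le_of_lt hγ) hδ.le
      have h3 : ε / (2 * B) * B = ε / 2 := by field_simp
      have h4 : |pairing f γ - pairing q.1 γ| < ε := by linarith
      exact h4
  have hb : @borel _ (vagueTopology d) ≤ MeasurableSpace.comap G MeasurableSpace.pi := by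
    have h1 : @borel _ (vagueTopology d) ≤ @borel _ tD := borel_anti hle
    have h2 : @borel _ tD = MeasurableSpace.comap G MeasurableSpace.pi := by
      rw [borel_comap, ← BorelSpace.measurable_eq]
    exact h1.trans h2.le
  refine Measurable.mono (mb := MeasurableSpace.comap G MeasurableSpace.pi) ?_ le_rfl hb
  exact measurable_comap_iff.2 (measurable_pi_lambda _ fun j => hg (F j))

/-- The normalization of a finite measure to a probability measure. -/
def pointLaw {d : ℕ} (μ : Measure (Space d)) : Measure (Space d) :=
  open Classical in if μ Set.univ = 0 then Measure.dirac 0 else (μ Set.univ)⁻¹ • μ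

instance {d : ℕ} (μ : Measure (Space d)) [IsFiniteMeasure μ] :
    IsProbabilityMeasure (pointLaw μ) := by
  unfold pointLaw
  split_ifs with h
  · infer_instance
  · refine ⟨?_⟩
    rw [Measure.smul_apply, smul_eq_mul]
    exact ENNReal.inv_mul_cancel h (measure_ne_top _ _)

lemma mul_lintegral_pointLaw {d : ℕ} (μ : Measure (Space d)) [IsFiniteMeasure μ]
    (g : Space d → ENNReal) : μ Set.univ * ∫⁻ x, g x ∂(pointLaw μ) = ∫⁻ x, g x ∂μ := by
  unfold pointLaw
  split_ifs with h
  · rw [Measure.measure_univ_eq_zero.1 h]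
    simp
  · rw [lintegral_smul_measure, smul_eq_mul, ← mul_assoc,
      ENNReal.mul_inv_cancel h (measure_ne_top _ _), one_mul]

/-- A Poisson distributed number of independent points. -/
def poissonSample {d : ℕ} (μ : Measure (Space d)) : Measure (ℕ × (ℕ → Space d)) :=
  (ProbabilityTheory.poissonMeasure (μ Set.univ).toNNReal).prod
    (Measure.infinitePi fun _ : ℕ => pointLaw μ)

instance {d : ℕ} (μ : Measure (Space d)) [IsFiniteMeasure μ] :
    IsProbabilityMeasure (poissonSample μ) := by
  unfold poissonSample
  infer_instance

lemma measurable_prod_sample {d : ℕ} {g : Space d → ENNReal} (hg : Measurable g) :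
    Measurable fun w : ℕ × (ℕ → Space d) => ∏ i ∈ Finset.range w.1, g (w.2 i) := by
  refine measurable_from_prod_countable_right fun k => ?_
  exact Finset.measurable_fun_prod (Finset.range k) fun i _ => hg.comp (measurable_pi_apply i)

lemma measurable_sum_sample {d : ℕ} {g : Space d → ℝ} (hg : Measurable g) :
    Measurable fun w : ℕ × (ℕ → Space d) => ∑ i ∈ Finset.range w.1, g (w.2 i) := by
  refine measurable_from_prod_countable_right fun k => ?_
  exact Finset.measurable_fun_sum (Finset.range k) fun i _ => hg.comp (measurable_pi_apply i)

lemma lintegral_poissonSample {d : ℕ} (μ : Measure (Space d)) [IsFiniteMeasure μ]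
    {g : Space d → ENNReal} (hg : Measurable g) (hgp : ∫⁻ x, g x ∂(pointLaw μ) ≠ ⊤) :
    ∫⁻ w, ∏ i ∈ Finset.range w.1, g (w.2 i) ∂(poissonSample μ) =
      ENNReal.ofReal (Real.exp ((∫⁻ x, g x ∂μ).toReal - μ.real Set.univ)) := by
  set c := ∫⁻ x, g x ∂(pointLaw μ) with hc
  have hin : ∀ k : ℕ, ∫⁻ x : ℕ → Space d, ∏ i ∈ Finset.range k, g (x i)
      ∂(Measure.infinitePi fun _ : ℕ => pointLaw μ) = c ^ k := by
    intro k
    rw [ProbabilityTheory.lintegral_prod_eq_prod_lintegral_of_indepFun (Finset.range k)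
      (fun i (x : ℕ → Space d) => g (x i))
      (ProbabilityTheory.iIndepFun_infinitePi (P := fun _ : ℕ => pointLaw μ)
        (X := fun _ => g) fun _ => hg) (fun i => by fun_prop)]
    rw [Finset.prod_congr rfl fun i _ =>
      (measurePreserving_eval_infinitePi (fun _ : ℕ => pointLaw μ) i).lintegral_comp hg]
    simp [hc]
  unfold poissonSample
  rw [lintegral_prod _ (measurable_prod_sample hg).aemeasurable]
  simp only [hin]
  rw [ProbabilityTheory.poissonMeasure, lintegral_sum_measure]
  simp only [lintegral_smul_measure, lintegral_dirac, smul_eq_mul]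
  have hcr : c = ENNReal.ofReal c.toReal := (ENNReal.ofReal_toReal hgp).symm
  have hmul : (μ Set.univ).toReal * c.toReal = (∫⁻ x, g x ∂μ).toReal := by
    rw [← mul_lintegral_pointLaw, ENNReal.toReal_mul]
  set r : ℝ := (μ Set.univ).toReal with hr
  have hr' : (((μ Set.univ).toNNReal : NNReal) : ℝ) = r := rfl
  have hr0 : 0 ≤ r := ENNReal.toReal_nonneg
  have hc0 : 0 ≤ c.toReal := ENNReal.toReal_nonneg
  have hterm : ∀ k : ℕ, ENNReal.ofReal (Real.exp (-r) * r ^ k / (k.factorial : ℝ)) * c ^ k =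
      ENNReal.ofReal (Real.exp (-r) * ((r * c.toReal) ^ k / (k.factorial : ℝ))) := by
    intro k
    rw [hcr, ← ENNReal.ofReal_pow hc0, ← ENNReal.ofReal_mul (by positivity),
      ENNReal.toReal_ofReal hc0]
    congr 1
    ring
  rw [hr']
  simp only [hterm]
  have hs : HasSum (fun k : ℕ => (r * c.toReal) ^ k / (k.factorial : ℝ))
      (Real.exp (r * c.toReal)) := by
    rw [Real.exp_eq_exp_ℝ]
    exact NormedSpace.expSeries_div_hasSum_exp (r * c.toReal)
  rw [← ENNReal.ofReal_tsum_of_nonneg (fun k => by positivity) (hs.mul_left _).summable,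
    (hs.mul_left _).tsum_eq, ← Real.exp_add, hmul]
  congr 2
  rw [measureReal_def]
  ring

/-- The measure `z(x) dx`. -/
def meanMeasure {d : ℕ} (z : Space d → ℝ) : Measure (Space d) :=
  volume.withDensity fun x => ENNReal.ofReal (z x)

/-- The spherical shell `n ≤ |x| < n + 1`. -/
def shell (d n : ℕ) : Set (Space d) := {x | ⌊‖x‖⌋₊ = n}

lemma measurableSet_shell (d n : ℕ) : MeasurableSet (shell d n) :=
  (measurable_norm.nat_floor) (measurableSet_singleton n)

lemma lt_of_mem_shell {d n : ℕ} {x : Space d} (hx : x ∈ shell d n) : ‖x‖ < n + 1 := by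
  have := Nat.lt_floor_add_one ‖x‖
  rwa [show ⌊‖x‖⌋₊ = n from hx] at this

lemma le_of_mem_shell {d n : ℕ} {x : Space d} (hx : x ∈ shell d n) : (n : ℝ) ≤ ‖x‖ := by
  have := Nat.floor_le (norm_nonneg x)
  rwa [show ⌊‖x‖⌋₊ = n from hx] at this

/-- The restriction of `z(x) dx` to a shell. -/
def shellMeasure {d : ℕ} (z : Space d → ℝ) (n : ℕ) : Measure (Space d) :=
  (meanMeasure z).restrict (shell d n)

lemma isFiniteMeasure_shellMeasure {d : ℕ} {z : Space d → ℝ} (hz : LocallyIntegrable z)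
    (n : ℕ) : IsFiniteMeasure (shellMeasure z n) := by
  refine ⟨?_⟩
  unfold shellMeasure meanMeasure
  rw [Measure.restrict_apply_univ, withDensity_apply _ (measurableSet_shell d n)]
  have h1 : IntegrableOn z (Metric.closedBall (0 : Space d) (n + 1)) :=
    hz.integrableOn_isCompact (isCompact_closedBall _ _)
  have h2 : IntegrableOn z (shell d n) := h1.mono_set fun x hx =>
    mem_closedBall_zero_iff.2 (lt_of_mem_shell hx).le
  exact h2.lintegral_lt_top

/-- All points of the samples in the shells. -/
def samplePoints {d : ℕ} (ω : ℕ → ℕ × (ℕ → Space d)) : Set (Space d) :=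
  {x | ∃ n i, i < (ω n).1 ∧ (ω n).2 i = x}

/-- The points lie in their shells and are distinct. -/
def goodSample {d : ℕ} (n : ℕ) (w : ℕ × (ℕ → Space d)) : Prop :=
  ∀ i < w.1, w.2 i ∈ shell d n ∧ ∀ j < w.1, w.2 i = w.2 j → i = j

lemma goodSample_image {d : ℕ} {ω : ℕ → ℕ × (ℕ → Space d)} (hω : ∀ n, goodSample n (ω n))
    {M n i : ℕ} (hi : i < (ω n).1) (hM : (ω n).2 i ∈ Metric.closedBall (0 : Space d) M) :
    (⟨n, i⟩ : Σ _ : ℕ, ℕ) ∈ (Finset.range (M + 1)).sigma fun n => Finset.range (ω n).1 := by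
  rw [Finset.mem_sigma, Finset.mem_range, Finset.mem_range]
  refine ⟨?_, hi⟩
  have h1 := le_of_mem_shell (hω n i hi).1
  have h2 := mem_closedBall_zero_iff.1 hM
  have h3 : (n : ℝ) ≤ M := h1.trans h2
  have h4 : n ≤ M := by exact_mod_cast h3
  show n < M + 1
  omega

lemma locFinite_samplePoints {d : ℕ} {ω : ℕ → ℕ × (ℕ → Space d)}
    (hω : ∀ n, goodSample n (ω n)) : LocFinite (samplePoints ω) := by
  classical
  intro K hK
  obtain ⟨R, hR⟩ := hK.isBounded.subset_closedBall 0
  obtain ⟨M, hM⟩ := exists_nat_ge R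
  refine (((Finset.range (M + 1)).sigma fun n => Finset.range (ω n).1).image
    fun p => (ω p.1).2 p.2).finite_toSet.subset ?_
  rintro x ⟨⟨n, i, hi, rfl⟩, hx⟩
  rw [Finset.mem_coe, Finset.mem_image]
  exact ⟨⟨n, i⟩, goodSample_image hω hi (Metric.closedBall_subset_closedBall hM (hR hx)), rfl⟩

/-- The sampled configuration. -/
def sampleConfig {d : ℕ} (ω : ℕ → ℕ × (ℕ → Space d)) : Configuration d :=
  open Classical in
  if hω : ∀ n, goodSample n (ω n) then ⟨samplePoints ω, locFinite_samplePoints hω⟩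
  else ⟨∅, locFinite_empty⟩

lemma pairing_sampleConfig {d : ℕ} {ω : ℕ → ℕ × (ℕ → Space d)}
    (hω : ∀ n, goodSample n (ω n)) {f : Space d → ℝ} {M : ℕ}
    (hf : ∀ x, x ∉ Metric.closedBall (0 : Space d) M → f x = 0) :
    pairing f (sampleConfig ω) =
      ∑ n ∈ Finset.range (M + 1), ∑ i ∈ Finset.range (ω n).1, f ((ω n).2 i) := by
  classical
  rw [← Finset.sum_sigma (Finset.range (M + 1)) (fun n => Finset.range (ω n).1)
    fun p => f ((ω p.1).2 p.2)]
  have hinj : Set.InjOn (fun p : Σ _ : ℕ, ℕ => (ω p.1).2 p.2)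
      ((Finset.range (M + 1)).sigma fun n => Finset.range (ω n).1 : Finset (Σ _ : ℕ, ℕ)) := by
    rintro ⟨n, i⟩ hp ⟨m, j⟩ hq hpq
    rw [Finset.mem_coe, Finset.mem_sigma, Finset.mem_range, Finset.mem_range] at hp hq
    have h1 : ⌊‖(ω n).2 i‖⌋₊ = n := (hω n i hp.2).1
    have h2 : ⌊‖(ω m).2 j‖⌋₊ = m := (hω m j hq.2).1
    have hpq' : (ω n).2 i = (ω m).2 j := hpq
    have hnm : n = m := by rw [← h1, ← h2, hpq']
    subst hnm
    have := (hω n i hp.2).2 j hq.2 hpq'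
    rw [this]
  rw [← Finset.sum_image (g := fun p : Σ _ : ℕ, ℕ => (ω p.1).2 p.2) (f := f) hinj]
  unfold pairing sampleConfig
  rw [dif_pos hω, tsum_subtype (samplePoints ω) f, tsum_eq_sum]
  · refine Finset.sum_congr rfl fun x hx => Set.indicator_of_mem ?_ f
    rw [Finset.mem_image] at hx
    obtain ⟨⟨n, i⟩, hp, rfl⟩ := hx
    rw [Finset.mem_sigma, Finset.mem_range, Finset.mem_range] at hp
    exact ⟨n, i, hp.2, rfl⟩
  · intro x hx
    by_cases hxs : x ∈ samplePoints ω
    · rw [Set.indicator_of_mem hxs]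
      refine hf x fun hxM => hx ?_
      obtain ⟨n, i, hi, rfl⟩ := hxs
      rw [Finset.mem_image]
      exact ⟨⟨n, i⟩, goodSample_image hω hi hxM, rfl⟩
    · exact Set.indicator_of_notMem hxs f

lemma measurableSet_goodSample (d n : ℕ) :
    MeasurableSet {w : ℕ × (ℕ → Space d) | goodSample n w} := by
  have hN : Measurable fun w : ℕ × (ℕ → Space d) => w.1 := measurable_fst
  have hx : ∀ i, Measurable fun w : ℕ × (ℕ → Space d) => w.2 i := fun i => by fun_prop
  have hlt : ∀ i, MeasurableSet {w : ℕ × (ℕ → Space d) | i < w.1} := fun i =>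
    hN (measurableSet_Ioi (a := i))
  have heq : ∀ i j, MeasurableSet {w : ℕ × (ℕ → Space d) | w.2 i = w.2 j} := fun i j =>
    measurableSet_eq_fun (hx i) (hx j)
  have hmem : ∀ i, MeasurableSet {w : ℕ × (ℕ → Space d) | w.2 i ∈ shell d n} := fun i =>
    hx i (measurableSet_shell d n)
  unfold goodSample
  refine measurableSet_setOfPred.2 (Measurable.forall fun i => ?_)
  refine (measurableSet_setOfPred.1 (hlt i)).imp ((measurableSet_setOfPred.1 (hmem i)).and ?_)
  exact Measurable.forall fun j => (measurableSet_setOfPred.1 (hlt j)).imp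
    ((measurableSet_setOfPred.1 (heq i j)).imp measurable_const)

lemma ae_goodSample {d : ℕ} (hd : 0 < d) {z : Space d → ℝ} (hz : LocallyIntegrable z) (n : ℕ) :
    ∀ᵐ w ∂(poissonSample (shellMeasure z n)), goodSample n w := by
  have := isFiniteMeasure_shellMeasure hz n
  have : Nonempty (Fin d) := ⟨⟨0, hd⟩⟩
  have hna : NullSingletonClass (shellMeasure z n) := by
    refine ⟨fun x => ?_⟩
    have h1 : meanMeasure z {x} = 0 :=
      withDensity_absolutelyContinuous _ _ (measure_singleton x)
    exact Measure.restrict_le_self.absolutelyContinuous h1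
  by_cases h0 : shellMeasure z n Set.univ = 0
  · have h1 : ∀ᵐ k ∂(ProbabilityTheory.poissonMeasure (shellMeasure z n Set.univ).toNNReal),
        k = 0 := by
      rw [h0, ENNReal.toNNReal_zero]
      refine (mem_ae_iff_prob_eq_one (s := {0}) (measurableSet_singleton 0)).2 ?_
      rw [ProbabilityTheory.poissonMeasure_singleton]
      simp
    have h2 := (Measure.quasiMeasurePreserving_fst
      (μ := ProbabilityTheory.poissonMeasure (shellMeasure z n Set.univ).toNNReal)
      (ν := Measure.infinitePi fun _ : ℕ => pointLaw (shellMeasure z n))).ae h1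
    filter_upwards [h2] with w hw i hi
    omega
  · have hpl : pointLaw (shellMeasure z n) =
        (shellMeasure z n Set.univ)⁻¹ • shellMeasure z n := by
      unfold pointLaw
      rw [if_neg h0]
    have hna' : NullSingletonClass (pointLaw (shellMeasure z n)) := by
      rw [hpl]
      exact ⟨fun x => by rw [Measure.smul_apply, measure_singleton, smul_zero]⟩
    have hsh : ∀ᵐ x ∂(pointLaw (shellMeasure z n)), x ∈ shell d n := by
      rw [hpl]
      refine Measure.ae_smul_measure ?_ _
      exact ae_restrict_mem (measurableSet_shell d n)
    have h1 : ∀ᵐ x ∂(Measure.infinitePi fun _ : ℕ => pointLaw (shellMeasure z n)),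
        ∀ i, x i ∈ shell d n := by
      rw [ae_all_iff]
      exact fun i => (measurePreserving_eval_infinitePi
        (fun _ : ℕ => pointLaw (shellMeasure z n)) i).quasiMeasurePreserving.ae hsh
    have h2 : ∀ᵐ x ∂(Measure.infinitePi fun _ : ℕ => pointLaw (shellMeasure z n)),
        ∀ i j, i ≠ j → x i ≠ x j := by
      rw [ae_all_iff]
      intro i
      rw [ae_all_iff]
      intro j
      by_cases hij : i = j
      · exact .of_forall fun x h => absurd hij h
      · have hdiag : ∀ᵐ p ∂((pointLaw (shellMeasure z n)).prod (pointLaw (shellMeasure z n))),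
            p.1 ≠ p.2 := by
          rw [Measure.ae_prod_iff_ae_ae]
          · refine .of_forall fun x => ?_
            have : ∀ᵐ y ∂(pointLaw (shellMeasure z n)), y ≠ x := by
              rw [ae_iff]
              simp
            filter_upwards [this] with y hy using hy.symm
          · exact (measurableSet_eq_fun measurable_fst measurable_snd).compl
        rw [← Measure.infinitePi_map_eval_prod (P := fun _ : ℕ => pointLaw (shellMeasure z n))
          hij] at hdiag
        have := ae_of_ae_map (by fun_prop) hdiag
        filter_upwards [this] with x hx _ using hx
    have h3 := (Measure.quasiMeasurePreserving_snd
      (μ := ProbabilityTheory.poissonMeasure (shellMeasure z n Set.univ).toNNReal)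
      (ν := Measure.infinitePi fun _ : ℕ => pointLaw (shellMeasure z n))).ae (h1.and h2)
    filter_upwards [h3] with w hw i hi
    refine ⟨hw.1 i, fun j _ hij => ?_⟩
    by_contra hne
    exact hw.2 i j hne hij

/-- **Existence of Poisson measures.** -/
theorem exists_isPoisson {d : ℕ} (hd : 0 < d) {z : Space d → ℝ} (hz0 : ∀ x, 0 ≤ z x)
    (hz : LocallyIntegrable z) : ∃ π : Measure (Configuration d), IsPoisson z π := by
  have hfin := isFiniteMeasure_shellMeasure hz
  set P : Measure (ℕ → ℕ × (ℕ → Space d)) :=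
    Measure.infinitePi fun n => poissonSample (shellMeasure z n) with hP
  have hgood : ∀ᵐ ω ∂P, ∀ n, goodSample n (ω n) := by
    rw [ae_all_iff]
    exact fun n => (measurePreserving_eval_infinitePi
      (fun n => poissonSample (shellMeasure z n)) n).quasiMeasurePreserving.ae
        (ae_goodSample hd hz n)
  have hsupp : ∀ f : Space d → ℝ, HasCompactSupport f →
      ∃ M : ℕ, ∀ x, x ∉ Metric.closedBall (0 : Space d) M → f x = 0 := by
    intro f hf
    obtain ⟨R, hR⟩ := hf.isCompact.isBounded.subset_closedBall 0
    obtain ⟨n, hn⟩ := exists_nat_ge R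
    refine ⟨n, fun x hx => ?_⟩
    by_contra hne
    exact hx (Metric.closedBall_subset_closedBall hn (hR (subset_tsupport _ hne)))
  have hmeas : Measurable (sampleConfig (d := d)) := by
    refine measurable_of_pairing fun f => ?_
    obtain ⟨M, hM⟩ := hsupp f f.hasCompactSupport'
    have hset : MeasurableSet {ω : ℕ → ℕ × (ℕ → Space d) | ∀ n, goodSample n (ω n)} :=
      measurableSet_setOfPred.2 (Measurable.forall fun n =>
        (measurableSet_setOfPred.1 (measurableSet_goodSample d n)).comp (measurable_pi_apply n))
    have hsum : Measurable fun ω : ℕ → ℕ × (ℕ → Space d) =>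
        ∑ n ∈ Finset.range (M + 1), ∑ i ∈ Finset.range (ω n).1, f ((ω n).2 i) := by
      refine Finset.measurable_fun_sum _ fun n _ => ?_
      exact (measurable_sum_sample f.continuous.measurable).comp (measurable_pi_apply n)
    have : (fun ω : ℕ → ℕ × (ℕ → Space d) => pairing f (sampleConfig ω)) =
        {ω | ∀ n, goodSample n (ω n)}.indicator fun ω =>
          ∑ n ∈ Finset.range (M + 1), ∑ i ∈ Finset.range (ω n).1, f ((ω n).2 i) := by
      funext ω
      by_cases hω : ∀ n, goodSample n (ω n)
      · rw [Set.indicator_of_mem (by exact hω)]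
        exact pairing_sampleConfig hω hM
      · rw [Set.indicator_of_notMem (by exact hω)]
        unfold sampleConfig pairing
        rw [dif_neg hω, tsum_subtype (∅ : Set (Space d)) f]
        simp
    rw [this]
    exact hsum.indicator hset
  refine ⟨P.map sampleConfig, Measure.isProbabilityMeasure_map hmeas.aemeasurable, fun φ => ?_⟩
  obtain ⟨M, hM⟩ := hsupp φ φ.hasCompactSupport
  have hφc : Continuous φ := φ.continuous
  have hpm : Measurable fun γ : Configuration d => pairing φ γ :=
    (continuous_pairing ⟨⟨φ, hφc⟩, φ.hasCompactSupport⟩).measurable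
  have hem : Measurable fun γ : Configuration d => Real.exp (pairing φ γ) :=
    Real.measurable_exp.comp hpm
  rw [integral_map hmeas.aemeasurable hem.aestronglyMeasurable]
  set g : Space d → ENNReal := fun x => ENNReal.ofReal (Real.exp (φ x)) with hg
  have hgm : Measurable g := by fun_prop
  obtain ⟨C, hC⟩ : ∃ C : ℝ, ∀ x, Real.exp (φ x) ≤ C := by
    obtain ⟨C, hC⟩ := hφc.bounded_above_of_compact_support φ.hasCompactSupport
    exact ⟨Real.exp C, fun x => Real.exp_le_exp.2 ((le_abs_self _).trans (hC x))⟩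
  have hgfin : ∀ μ : Measure (Space d), IsFiniteMeasure μ → ∫⁻ x, g x ∂μ ≠ ⊤ := by
    intro μ hμ
    refine ((lintegral_mono fun x => ENNReal.ofReal_le_ofReal (hC x)).trans_lt ?_).ne
    rw [lintegral_const]
    exact ENNReal.mul_lt_top ENNReal.ofReal_lt_top (measure_lt_top _ _)
  have hshell : ∀ n, (∫⁻ x, g x ∂(shellMeasure z n)).toReal - (shellMeasure z n).real Set.univ =
      ∫ x in shell d n, (Real.exp (φ x) - 1) * z x := by
    intro n
    have h1 : ∫ x, (Real.exp (φ x) - 1) ∂(shellMeasure z n) =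
        (∫⁻ x, g x ∂(shellMeasure z n)).toReal - (shellMeasure z n).real Set.univ := by
      have hi : Integrable (fun x => Real.exp (φ x)) (shellMeasure z n) := by
        refine ⟨by fun_prop, ?_⟩
        rw [hasFiniteIntegral_iff_ofReal (.of_forall fun _ => (Real.exp_pos _).le)]
        exact (hgfin _ inferInstance).lt_top
      rw [integral_sub hi (integrable_const 1), integral_const, smul_eq_mul, mul_one,
        integral_eq_lintegral_of_nonneg_ae (.of_forall fun _ => (Real.exp_pos _).le)
          hi.aestronglyMeasurable]
    rw [← h1]
    unfold shellMeasure meanMeasure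
    rw [restrict_withDensity (measurableSet_shell d n),
      integral_withDensity_eq_integral_toReal_smul₀]
    · refine integral_congr_ae (.of_forall fun x => ?_)
      simp only [ENNReal.toReal_ofReal (hz0 x), smul_eq_mul]
      ring
    · exact (hz.aestronglyMeasurable.aemeasurable.ennreal_ofReal).restrict
    · exact .of_forall fun _ => ENNReal.ofReal_lt_top
  have hexp : ∫⁻ ω, ENNReal.ofReal (Real.exp (pairing φ (sampleConfig ω))) ∂P =
      ENNReal.ofReal (Real.exp (∫ x, (Real.exp (φ x) - 1) * z x)) := by
    calc ∫⁻ ω, ENNReal.ofReal (Real.exp (pairing φ (sampleConfig ω))) ∂P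
        = ∫⁻ ω, ∏ n ∈ Finset.range (M + 1),
            ∏ i ∈ Finset.range (ω n).1, g ((ω n).2 i) ∂P := by
          refine lintegral_congr_ae ?_
          filter_upwards [hgood] with ω hω
          rw [pairing_sampleConfig hω hM, Real.exp_sum,
            ENNReal.ofReal_prod_of_nonneg fun _ _ => (Real.exp_pos _).le]
          refine Finset.prod_congr rfl fun n _ => ?_
          rw [Real.exp_sum, ENNReal.ofReal_prod_of_nonneg fun _ _ => (Real.exp_pos _).le]
      _ = ∏ n ∈ Finset.range (M + 1), ∫⁻ ω, ∏ i ∈ Finset.range (ω n).1, g ((ω n).2 i) ∂P := by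
          exact ProbabilityTheory.lintegral_prod_eq_prod_lintegral_of_indepFun _
            (fun n (ω : ℕ → ℕ × (ℕ → Space d)) => ∏ i ∈ Finset.range (ω n).1, g ((ω n).2 i))
            (ProbabilityTheory.iIndepFun_infinitePi
              (X := fun _ (w : ℕ × (ℕ → Space d)) => ∏ i ∈ Finset.range w.1, g (w.2 i))
              fun _ => measurable_prod_sample hgm)
            (fun n => (measurable_prod_sample hgm).comp (measurable_pi_apply n))
      _ = ∏ n ∈ Finset.range (M + 1),
            ENNReal.ofReal (Real.exp (∫ x in shell d n, (Real.exp (φ x) - 1) * z x)) := by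
          refine Finset.prod_congr rfl fun n _ => ?_
          rw [(measurePreserving_eval_infinitePi
            (fun n => poissonSample (shellMeasure z n)) n).lintegral_comp
              (measurable_prod_sample hgm),
            lintegral_poissonSample _ hgm (hgfin _ inferInstance), hshell]
      _ = ENNReal.ofReal (Real.exp (∫ x, (Real.exp (φ x) - 1) * z x)) := by
          rw [← ENNReal.ofReal_prod_of_nonneg fun _ _ => (Real.exp_pos _).le, ← Real.exp_sum]
          congr 2
          have hint : Integrable fun x => (Real.exp (φ x) - 1) * z x := by
            have hcs : HasCompactSupport fun x => Real.exp (φ x) - 1 :=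
              φ.hasCompactSupport.comp_left (g := fun y => Real.exp y - 1) (by simp)
            have := hz.integrable_smul_left_of_hasCompactSupport
              (g := fun x => Real.exp (φ x) - 1) (by fun_prop) hcs
            simpa only [smul_eq_mul] using this
          rw [← integral_biUnion_finset _ (fun n _ => measurableSet_shell d n) ?_
            fun n _ => hint.integrableOn]
          · refine setIntegral_eq_integral_of_forall_compl_eq_zero fun x hx => ?_
            have : φ x = 0 := by
              refine hM x fun hxM => hx ?_
              rw [Set.mem_iUnion₂]
              refine ⟨⌊‖x‖⌋₊, ?_, rfl⟩
              rw [Finset.mem_range, Nat.lt_succ_iff]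
              exact Nat.floor_le_of_le (mem_closedBall_zero_iff.1 hxM)
            rw [this]
            simp
          · intro n _ m _ hnm
            refine Set.disjoint_left.2 fun x hx hx' => hnm ?_
            have h1 : ⌊‖x‖⌋₊ = n := hx
            have h2 : ⌊‖x‖⌋₊ = m := hx'
            omega
  rw [integral_eq_lintegral_of_nonneg_ae (.of_forall fun _ => (Real.exp_pos _).le)
    (hem.comp hmeas).aestronglyMeasurable, hexp,
    ENNReal.toReal_ofReal (Real.exp_pos _).le]

/-- The Poisson measure `π_z` on `Γ` with intensity `z`. -/
def poissonMeasure {d : ℕ} (z : Space d → ℝ) : Measure (Configuration d) :=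
  open Classical in if h : ∃ π, IsPoisson z π then h.choose else 0

lemma isPoisson_poissonMeasure {d : ℕ} (hd : 0 < d) {z : Space d → ℝ} (hz0 : ∀ x, 0 ≤ z x)
    (hz : LocallyIntegrable z) : IsPoisson z (poissonMeasure z) := by
  have h := exists_isPoisson hd hz0 hz
  unfold poissonMeasure
  rw [dif_pos h]
  exact h.choose_spec

/-! ### The particle process -/

/-- The total jump rate `a⁽⁰⁾ = ∫ a`. -/
def totalRate {d : ℕ} (a : Space d → ℝ) : ℝ := ∫ x, a x

/-- The law `a(u) du / a⁽⁰⁾` of the jumps (with no jumps at all if `a⁽⁰⁾ = 0`). -/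
def jumpLaw {d : ℕ} (a : Space d → ℝ) : Measure (Space d) :=
  open Classical in
  if totalRate a = 0 then Measure.dirac 0
  else volume.withDensity fun u => ENNReal.ofReal (a u / totalRate a)

lemma isProbabilityMeasure_jumpLaw {d : ℕ} {a : Space d → ℝ} (ha : ∀ x, 0 ≤ a x)
    (hai : Integrable a) : IsProbabilityMeasure (jumpLaw a) := by
  unfold jumpLaw
  split_ifs with h
  · infer_instance
  · refine ⟨?_⟩
    have h0 : 0 ≤ totalRate a := integral_nonneg ha
    rw [withDensity_apply _ MeasurableSet.univ, Measure.restrict_univ,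
      ← ofReal_integral_eq_lintegral_ofReal (hai.div_const _)
        (.of_forall fun x => div_nonneg (ha x) h0), integral_div]
    change ENNReal.ofReal (totalRate a / totalRate a) = 1
    rw [div_self h, ENNReal.ofReal_one]

/-- The randomness driving one particle: standard exponential clocks `τ` and jumps `ξ`. -/
abbrev Noise (d : ℕ) : Type := (ℕ → ℝ) × (ℕ → Space d)

/-- All clocks and jumps are independent, the clocks exponentially distributed with mean one. -/
def noiseLaw {d : ℕ} (a : Space d → ℝ) : Measure (Noise d) :=
  (Measure.infinitePi fun _ : ℕ => ProbabilityTheory.expMeasure 1).prod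
    (Measure.infinitePi fun _ : ℕ => jumpLaw a)

lemma isProbabilityMeasure_noiseLaw {d : ℕ} {a : Space d → ℝ} (ha : ∀ x, 0 ≤ a x)
    (hai : Integrable a) : IsProbabilityMeasure (noiseLaw a) := by
  have := isProbabilityMeasure_jumpLaw ha hai
  have := ProbabilityTheory.isProbabilityMeasure_expMeasure one_pos
  unfold noiseLaw
  infer_instance

/-- The Poisson process `Z_s` of rate `r`: the `n`-th waiting time is `τ n / r`, so `Z_s` is the
number of partial sums of the clocks that do not exceed `r s`. -/
def poissonProcess (r : ℝ) (τ : ℕ → ℝ) (s : ℝ) : ℕ :=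
  {n : ℕ | ∑ i ∈ Finset.range (n + 1), τ i ≤ r * s}.ncard

/-- The Markov chain `Y_k` started at `x`. Its transition density from `x` to `y` is
`a (x - y) / a⁽⁰⁾`, i.e. `x - y` has the law `jumpLaw a`. -/
def jumpChain {d : ℕ} (x : Space d) (ξ : ℕ → Space d) (k : ℕ) : Space d :=
  x - ∑ i ∈ Finset.range k, ξ i

/-- The one-particle jump process `X_s = Y_{Z_s}` started at `x`. -/
def particle {d : ℕ} (a : Space d → ℝ) (x : Space d) (ω : Noise d) (s : ℝ) : Space d :=
  jumpChain x ω.2 (poissonProcess (totalRate a) ω.1 s)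

/-- The infinite particle process `𝐗_s` started at `γ`: each `x ∈ γ` moves as a one-particle jump
process with its own noise `ω x`. (If infinitely many particles meet a compact set, an event which
is negligible, we put `𝐗_s = ∅`.) -/
def particleSystem {d : ℕ} (a : Space d → ℝ) (γ : Configuration d) (ω : γ.1 → Noise d) (s : ℝ) :
    Configuration d :=
  open Classical in
  if h : LocFinite (Set.range fun x : γ.1 => particle a x (ω x) s) then ⟨_, h⟩
  else ⟨∅, locFinite_empty⟩

/-- The law of the noise of all particles of `γ`: the particles move independently. -/
def systemLaw {d : ℕ} (a : Space d → ℝ) (γ : Configuration d) : Measure (γ.1 → Noise d) :=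
  Measure.infinitePi fun _ : γ.1 => noiseLaw a

/-! ### The scaled empirical field -/

/-- The scaled empirical field
`n_t^(ε)(φ, 𝐗) = ε^d ⟨φ(ε ·), 𝐗_{ε^{-κ} t}⟩`. -/
def scaledField {d : ℕ} (a : Space d → ℝ) (κ : ℕ) (t ε : ℝ) (φ : Space d → ℝ)
    (γ : Configuration d) (ω : γ.1 → Noise d) : ℝ :=
  ε ^ d * pairing (fun x => φ (ε • x)) (particleSystem a γ ω (t / ε ^ κ))

/-- `𝐄_γ[exp n_t^(ε)(φ, 𝐗)]`. -/
def quenchedLaplace {d : ℕ} (a : Space d → ℝ) (κ : ℕ) (t ε : ℝ) (φ : Space d → ℝ)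
    (γ : Configuration d) : ℝ :=
  ∫ ω, Real.exp (scaledField a κ t ε φ γ ω) ∂(systemLaw a γ)

/-- `ρ` is the hydrodynamic limit at time `t`: started from the Poisson measures `π_{z(ε ·)}`, the
Laplace transform `∫_Θ π_{z(ε ·)}(dγ) 𝐄_γ[exp n_t^(ε)(φ, 𝐗)]` of the scaled empirical field is
well defined (all integrals converge) and tends to `exp ⟨φ, ρ⟩`, for all test functions `φ`. -/
def IsHydrodynamicLimit {d : ℕ} (a z : Space d → ℝ) (κ : ℕ) (t : ℝ)
    (ρ : 𝓓'((⊤ : TopologicalSpace.Opens (Space d)), ℝ)) : Prop :=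
  ∀ φ : 𝓓((⊤ : TopologicalSpace.Opens (Space d)), ℝ),
    (∀ ε : ℝ, 0 < ε →
      let μ := (poissonMeasure fun x => z (ε • x)).restrict (admissible d)
      (∀ᵐ γ ∂μ, Integrable (fun ω => Real.exp (scaledField a κ t ε φ γ ω)) (systemLaw a γ)) ∧
        Integrable (quenchedLaplace a κ t ε φ) μ) ∧
    Tendsto
      (fun ε : ℝ => ∫ γ in admissible d, quenchedLaplace a κ t ε φ γ
        ∂(poissonMeasure fun x => z (ε • x)))
      (𝓝[>] 0) (𝓝 (Real.exp (ρ φ)))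

/-! ### Fourier transform and moments -/

/-- The Fourier transform `f^(k) = (2π)^{-d/2} ∫ e^{-i⟨x, k⟩} f(x) dx`. -/
def fourierTr {d : ℕ} (f : Space d → ℂ) (k : Space d) : ℂ :=
  (((2 * Real.pi) ^ (-(d : ℝ) / 2) : ℝ) : ℂ) *
    ∫ x, Complex.exp (-(Complex.I * (inner ℝ x k : ℝ))) * f x

/-- The Fourier transform of `z`, as a tempered distribution, is a (complex-valued) signed measure:
it is given by a measure with polar decomposition `h m`, where `m ≥ 0` is its total variation and
`|h| = 1`, against which all Schwartz functions are integrable. Finite signed and complex measures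
are included; the total variation need not be finite. Complex values must be allowed, since the
Fourier transform of a real function is real-valued only if the function is even. -/
def FourierIsSignedMeasure {d : ℕ} (z : Space d → ℝ) : Prop :=
  ∃ (m : Measure (Space d)) (h : Space d → ℂ), Measurable h ∧ (∀ k, ‖h k‖ = 1) ∧
    ∀ ψ : 𝓢(Space d, ℂ), Integrable (fun k => ψ k * h k) m ∧
      ∫ x, (z x : ℂ) * fourierTr ψ x = ∫ k, ψ k * h k ∂m

/-- The vector `a⁽¹⁾` of first moments. -/
def firstMoment {d : ℕ} (a : Space d → ℝ) : Space d :=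
  WithLp.toLp 2 fun i => ∫ x, x i * a x

/-- The matrix `a⁽²⁾` of second moments. -/
def secondMoment {d : ℕ} (a : Space d → ℝ) : Matrix (Fin d) (Fin d) ℝ :=
  Matrix.of fun i j => ∫ x, x i * x j * a x

/-- The quadratic form `⟨M k, k⟩`. -/
def quadForm {d : ℕ} (M : Matrix (Fin d) (Fin d) ℝ) (k : Space d) : ℝ :=
  ∑ i, ∑ j, M i j * k i * k j

end FreeKawasaki

end

open FreeKawasaki

noncomputable section

namespace FreeKawasaki

/-! ### The law of a single particle -/

section PartialSums

variable {E : Type*} [MeasurableSpace E] [AddCommMonoid E] [MeasurableAdd₂ E]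

lemma indepFun_sum_range_eval (μ : Measure E) [IsProbabilityMeasure μ] (n : ℕ) :
    ProbabilityTheory.IndepFun (fun x : ℕ → E => ∑ i ∈ Finset.range n, x i) (fun x => x n)
      (Measure.infinitePi fun _ : ℕ => μ) := by
  have h := ProbabilityTheory.iIndepFun_infinitePi (P := fun _ : ℕ => μ)
    (X := fun _ => (id : E → E)) fun _ => measurable_id
  have := h.indepFun_finsetSum_of_notMem (fun i => by fun_prop) (s := Finset.range n) (i := n)
    (by simp)
  convert! this using 1
  ext x
  simp

/-- The partial sum of the first `n` terms is independent of the next term. -/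
lemma lintegral_sum_range_eval (μ : Measure E) [IsProbabilityMeasure μ] (n : ℕ)
    {f : E × E → ENNReal} (hf : Measurable f) :
    ∫⁻ x, f (∑ i ∈ Finset.range n, x i, x n) ∂(Measure.infinitePi fun _ : ℕ => μ) =
      ∫⁻ x, ∫⁻ y, f (∑ i ∈ Finset.range n, x i, y) ∂μ ∂(Measure.infinitePi fun _ : ℕ => μ) := by
  have h := (indepFun_sum_range_eval μ n).map_prod_eq_prod_map_map
    (by fun_prop) (measurable_pi_apply n).aemeasurable
  rw [Measure.infinitePi_map_eval] at h
  rw [← lintegral_map (μ := Measure.infinitePi fun _ : ℕ => μ)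
      (g := fun x : ℕ → E => (∑ i ∈ Finset.range n, x i, x n)) hf (by fun_prop), h,
    lintegral_prod _ hf.aemeasurable, lintegral_map hf.lintegral_prod_right' (by fun_prop)]

end PartialSums

section Clocks

open ProbabilityTheory

instance : IsProbabilityMeasure (expMeasure 1) := isProbabilityMeasure_expMeasure one_pos

lemma lintegral_expMeasure_one {f : ℝ → ENNReal} (hf : Measurable f) :
    ∫⁻ x, f x ∂(expMeasure 1) = ∫⁻ x in Set.Ici 0, ENNReal.ofReal (Real.exp (-x)) * f x := by
  have h : Measurable (exponentialPDF 1) := (measurable_exponentialPDFReal 1).ennreal_ofReal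
  change ∫⁻ x, f x ∂(volume.withDensity (exponentialPDF 1)) = _
  rw [lintegral_withDensity_eq_lintegral_mul _ h hf, ← lintegral_indicator measurableSet_Ici]
  refine lintegral_congr fun x => ?_
  by_cases hx : x ∈ Set.Ici (0 : ℝ)
  · rw [Set.indicator_of_mem hx, Pi.mul_apply, exponentialPDF_of_nonneg hx]
    simp
  · rw [Set.indicator_of_notMem hx, Pi.mul_apply, exponentialPDF_of_neg (not_le.1 hx), zero_mul]

lemma expMeasure_one_Ioi {y : ℝ} (hy : 0 ≤ y) :
    expMeasure 1 (Set.Ioi y) = ENNReal.ofReal (Real.exp (-y)) := by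
  have h0 : Real.exp (-y) ≤ 1 := Real.exp_le_one_iff.2 (by linarith)
  rw [← Set.compl_Iic, prob_compl_eq_one_sub measurableSet_Iic, ← ofReal_cdf,
    cdf_expMeasure_eq one_pos, if_pos hy, one_mul, ← ENNReal.ofReal_one,
    ← ENNReal.ofReal_sub _ (by linarith)]
  congr 1
  ring

lemma ae_expMeasure_one_nonneg : ∀ᵐ x ∂(expMeasure 1), 0 ≤ x := by
  have h : MeasurableSet {x : ℝ | ¬ 0 ≤ x} :=
    (measurableSet_Ici (a := (0 : ℝ))).compl
  rw [ae_iff, ← lintegral_indicator_one h,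
    lintegral_expMeasure_one (measurable_one.indicator h),
    setLIntegral_congr_fun measurableSet_Ici (g := fun _ => 0)]
  · simp
  · intro x hx
    have : x ∉ {x : ℝ | ¬ 0 ≤ x} := fun h => h hx
    simp only [Set.indicator_of_notMem this, mul_zero]

/-- The law of the clocks. -/
abbrev clockLaw : Measure (ℕ → ℝ) := Measure.infinitePi fun _ : ℕ => expMeasure 1

lemma integral_sub_pow (T : ℝ) (n : ℕ) :
    ∫ x in (0 : ℝ)..T, (T - x) ^ n / (n.factorial : ℝ) =
      T ^ (n + 1) / ((n + 1).factorial : ℝ) := by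
  have h0 := intervalIntegral.integral_comp_sub_left (a := 0) (b := T)
    (fun x : ℝ => x ^ n / (n.factorial : ℝ)) T
  simp only [sub_self, sub_zero] at h0
  rw [h0, intervalIntegral.integral_div, integral_pow, Nat.factorial_succ]
  have : (n.factorial : ℝ) ≠ 0 := by positivity
  push_cast
  field_simp
  simp

lemma lintegral_exp_sum_clocks (n : ℕ) (T : ℝ) :
    ∫⁻ τ, (if ∑ i ∈ Finset.range n, τ i ≤ T then
        ENNReal.ofReal (Real.exp (-(T - ∑ i ∈ Finset.range n, τ i))) else 0) ∂clockLaw =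
      if 0 ≤ T then ENNReal.ofReal (Real.exp (-T) * T ^ n / n.factorial) else 0 := by
  induction n generalizing T with
  | zero => simp
  | succ n ih =>
    have hm : Measurable fun p : ℝ × ℝ => if p.1 + p.2 ≤ T then
        ENNReal.ofReal (Real.exp (-(T - (p.1 + p.2)))) else 0 :=
      Measurable.ite (measurableSet_le (by fun_prop) (by fun_prop)) (by fun_prop) (by fun_prop)
    simp only [Finset.sum_range_succ]
    rw [lintegral_sum_range_eval (expMeasure 1) n hm, lintegral_lintegral_swap]
    · have h1 : ∀ y : ℝ, ∫⁻ τ : ℕ → ℝ, (if ∑ i ∈ Finset.range n, τ i + y ≤ T then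
          ENNReal.ofReal (Real.exp (-(T - (∑ i ∈ Finset.range n, τ i + y)))) else 0) ∂clockLaw =
          if 0 ≤ T - y then
            ENNReal.ofReal (Real.exp (-(T - y)) * (T - y) ^ n / n.factorial) else 0 := by
        intro y
        rw [← ih (T - y)]
        refine lintegral_congr fun τ => ?_
        simp only [le_sub_iff_add_le, sub_sub, add_comm y]
      simp only [h1]
      rw [lintegral_expMeasure_one (Measurable.ite (measurableSet_le (by fun_prop) (by fun_prop))
        (by fun_prop) (by fun_prop))]
      by_cases hT : 0 ≤ T
      · rw [if_pos hT]
        have h2 : ∫⁻ x in Set.Ici (0 : ℝ), ENNReal.ofReal (Real.exp (-x)) *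
            (if 0 ≤ T - x then ENNReal.ofReal (Real.exp (-(T - x)) * (T - x) ^ n / n.factorial)
              else 0) =
            ∫⁻ x in Set.Icc 0 T, ENNReal.ofReal (Real.exp (-T) * ((T - x) ^ n / n.factorial)) := by
          rw [← lintegral_indicator measurableSet_Ici, ← lintegral_indicator measurableSet_Icc]
          refine lintegral_congr fun x => ?_
          by_cases hx : 0 ≤ x
          · rw [Set.indicator_of_mem (Set.mem_Ici.2 hx)]
            by_cases hxT : x ≤ T
            · rw [Set.indicator_of_mem (Set.mem_Icc.2 ⟨hx, hxT⟩), if_pos (sub_nonneg.2 hxT),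
                ← ENNReal.ofReal_mul (Real.exp_pos _).le]
              congr 1
              rw [mul_div_assoc, ← mul_assoc, ← Real.exp_add]
              congr 2
              ring
            · rw [Set.indicator_of_notMem (fun h => hxT h.2), if_neg (by linarith), mul_zero]
          · rw [Set.indicator_of_notMem (by exact hx), Set.indicator_of_notMem fun h => hx h.1]
        rw [h2, ← ofReal_integral_eq_lintegral_ofReal, integral_Icc_eq_integral_Ioc,
          ← intervalIntegral.integral_of_le hT, intervalIntegral.integral_const_mul,
          integral_sub_pow, mul_div_assoc]
        · exact (Continuous.integrableOn_Icc (by fun_prop))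
        · filter_upwards [ae_restrict_mem measurableSet_Icc] with x hx
          have : 0 ≤ T - x := sub_nonneg.2 hx.2
          change 0 ≤ Real.exp (-T) * ((T - x) ^ n / n.factorial)
          positivity
      · rw [if_neg hT, setLIntegral_congr_fun measurableSet_Ici (g := fun _ => 0)]
        · simp
        · intro x hx
          have : (0 : ℝ) ≤ x := hx
          have h' : ¬ 0 ≤ T - x := by linarith
          simp only [if_neg h', mul_zero]
    · refine (Measurable.aemeasurable ?_)
      exact hm.comp (Measurable.prodMk (by fun_prop) (by fun_prop))

lemma clockLaw_between {T : ℝ} (hT : 0 ≤ T) (n : ℕ) :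
    clockLaw {τ | ∑ i ∈ Finset.range n, τ i ≤ T ∧ T < ∑ i ∈ Finset.range (n + 1), τ i} =
      ENNReal.ofReal (Real.exp (-T) * T ^ n / n.factorial) := by
  have hs : MeasurableSet {p : ℝ × ℝ | p.1 ≤ T ∧ T < p.1 + p.2} :=
    (measurableSet_le measurable_fst measurable_const).inter
      (measurableSet_lt measurable_const (measurable_fst.add measurable_snd))
  have h := lintegral_sum_range_eval (expMeasure 1) n (measurable_one.indicator hs)
    (f := Set.indicator {p : ℝ × ℝ | p.1 ≤ T ∧ T < p.1 + p.2} 1)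
  have hs' : MeasurableSet {τ : ℕ → ℝ | ∑ i ∈ Finset.range n, τ i ≤ T ∧
      T < ∑ i ∈ Finset.range (n + 1), τ i} :=
    (measurableSet_le (f := fun τ : ℕ → ℝ => ∑ i ∈ Finset.range n, τ i) (by fun_prop)
      measurable_const).inter (measurableSet_lt measurable_const
        (g := fun τ : ℕ → ℝ => ∑ i ∈ Finset.range (n + 1), τ i) (by fun_prop))
  have hp := lintegral_exp_sum_clocks n T
  rw [if_pos hT] at hp
  rw [← lintegral_indicator_one hs', ← hp]
  refine Eq.trans ?_ (h.trans ?_)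
  · refine lintegral_congr fun τ => ?_
    simp only [Set.indicator_apply, Set.mem_ofPred_eq, Finset.sum_range_succ, Pi.one_apply]
  · refine lintegral_congr fun τ => ?_
    set S := ∑ i ∈ Finset.range n, τ i
    by_cases hS : S ≤ T
    · rw [if_pos hS, ← expMeasure_one_Ioi (sub_nonneg.2 hS),
        ← lintegral_indicator_one measurableSet_Ioi]
      refine lintegral_congr fun y => ?_
      simp only [Set.indicator_apply, Set.mem_ofPred_eq, Set.mem_Ioi, hS, true_and,
        sub_lt_iff_lt_add', Pi.one_apply]
    · simp [hS]

lemma measurable_poissonProcess (r s : ℝ) :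
    Measurable fun τ : ℕ → ℝ => poissonProcess r τ s := by
  have h : (fun τ : ℕ → ℝ => poissonProcess r τ s) = fun τ => ⌊(∑' n : ℕ,
      ({τ : ℕ → ℝ | ∑ i ∈ Finset.range (n + 1), τ i ≤ r * s}.indicator 1 τ : ENNReal)).toReal⌋₊ := by
    funext τ
    set A : Set ℕ := {n : ℕ | ∑ i ∈ Finset.range (n + 1), τ i ≤ r * s} with hA
    have h1 : (∑' n : ℕ,
        ({τ : ℕ → ℝ | ∑ i ∈ Finset.range (n + 1), τ i ≤ r * s}.indicator 1 τ : ENNReal)) =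
        (A.encard : ENNReal) := by
      rw [← ENNReal.tsum_set_one, tsum_subtype A fun _ => (1 : ENNReal)]
      rfl
    rw [h1]
    change A.ncard = _
    by_cases hfin : A.Finite
    · rw [← hfin.cast_ncard_eq]
      simp
    · rw [Set.Infinite.ncard hfin, Set.Infinite.encard_eq hfin]
      simp
  rw [h]
  refine Nat.measurable_floor.comp (ENNReal.measurable_toReal.comp ?_)
  refine Measurable.tsum fun n => measurable_one.indicator ?_
  exact measurableSet_le (by fun_prop) (by fun_prop)

lemma poissonProcess_eq {τ : ℕ → ℝ} (hτ : ∀ i, 0 ≤ τ i) {r s : ℝ} {n : ℕ}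
    (h1 : ∑ i ∈ Finset.range n, τ i ≤ r * s) (h2 : r * s < ∑ i ∈ Finset.range (n + 1), τ i) :
    poissonProcess r τ s = n := by
  have hmono : Monotone fun n => ∑ i ∈ Finset.range n, τ i := by
    refine monotone_nat_of_le_succ fun n => ?_
    rw [Finset.sum_range_succ]
    linarith [hτ n]
  have : {k : ℕ | ∑ i ∈ Finset.range (k + 1), τ i ≤ r * s} = Finset.range n := by
    ext k
    rw [Set.mem_ofPred_eq, Finset.coe_range, Set.mem_Iio]
    constructor
    · intro hk
      by_contra hkn
      have := hmono (show n + 1 ≤ k + 1 by omega)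
      simp only at this
      linarith
    · intro hk
      exact (hmono (show k + 1 ≤ n by omega)).trans h1
  unfold poissonProcess
  rw [this, Set.ncard_coe_finset, Finset.card_range]

/-- The number of jumps up to time `s` has the Poisson distribution with mean `r s`. -/
lemma map_poissonProcess {r s : ℝ} (hT : 0 ≤ r * s) :
    clockLaw.map (fun τ => poissonProcess r τ s) =
      ProbabilityTheory.poissonMeasure (r * s).toNNReal := by
  have hm := measurable_poissonProcess r s
  have : IsProbabilityMeasure (clockLaw.map (fun τ => poissonProcess r τ s)) :=
    Measure.isProbabilityMeasure_map hm.aemeasurable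
  symm
  refine Measure.eq_of_le_of_isProbabilityMeasure ?_
  refine Measure.le_iff.2 fun A _ => ?_
  rw [← Measure.tsum_indicator_apply_singleton _ A A.to_countable.measurableSet,
    ← Measure.tsum_indicator_apply_singleton _ A A.to_countable.measurableSet]
  refine ENNReal.tsum_le_tsum fun n => Set.indicator_le_indicator ?_
  rw [ProbabilityTheory.poissonMeasure_singleton, Measure.map_apply hm (measurableSet_singleton n),
    Real.coe_toNNReal _ hT, ← clockLaw_between hT n]
  refine measure_mono_ae ?_
  have hτ : ∀ᵐ τ ∂clockLaw, ∀ i, 0 ≤ τ i := by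
    rw [ae_all_iff]
    exact fun i => (measurePreserving_eval_infinitePi
      (fun _ : ℕ => expMeasure 1) i).quasiMeasurePreserving.ae ae_expMeasure_one_nonneg
  filter_upwards [hτ] with τ hτ h
  exact poissonProcess_eq hτ h.1 h.2

end Clocks

section Displacement

variable {d : ℕ} {a : Space d → ℝ}

/-- The sum of the jumps of a particle up to time `s`. -/
def displacement (a : Space d → ℝ) (s : ℝ) (ω : Noise d) : Space d :=
  ∑ i ∈ Finset.range (poissonProcess (totalRate a) ω.1 s), ω.2 i

lemma measurable_sum_range :
    Measurable fun w : ℕ × (ℕ → Space d) => ∑ i ∈ Finset.range w.1, w.2 i :=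
  measurable_from_prod_countable_right fun k => by
    change Measurable fun x : ℕ → Space d => ∑ i ∈ Finset.range k, x i
    fun_prop

lemma measurable_displacement (a : Space d → ℝ) (s : ℝ) : Measurable (displacement a s) :=
  measurable_sum_range.comp
    (((measurable_poissonProcess _ s).comp measurable_fst).prodMk measurable_snd)

/-- The law of the displacement of a particle up to time `s`. -/
def displacementLaw (a : Space d → ℝ) (s : ℝ) : Measure (Space d) :=
  (noiseLaw a).map (displacement a s)

lemma isProbabilityMeasure_displacementLaw (ha : ∀ x, 0 ≤ a x) (hai : Integrable a) (s : ℝ) :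
    IsProbabilityMeasure (displacementLaw a s) := by
  have := isProbabilityMeasure_noiseLaw ha hai
  exact Measure.isProbabilityMeasure_map (measurable_displacement a s).aemeasurable

lemma totalRate_nonneg (ha : ∀ x, 0 ≤ a x) : 0 ≤ totalRate a := integral_nonneg ha

lemma displacementLaw_eq_map_prod (ha : ∀ x, 0 ≤ a x) (hai : Integrable a) {s : ℝ} (hs : 0 ≤ s) :
    displacementLaw a s =
      ((ProbabilityTheory.poissonMeasure (totalRate a * s).toNNReal).prod
        (Measure.infinitePi fun _ : ℕ => jumpLaw a)).map
        fun w => ∑ i ∈ Finset.range w.1, w.2 i := by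
  have := isProbabilityMeasure_jumpLaw ha hai
  rw [← map_poissonProcess (mul_nonneg (totalRate_nonneg ha) hs)]
  have hid := Measure.map_id (μ := Measure.infinitePi fun _ : ℕ => jumpLaw a)
  rw [← hid, Measure.map_prod_map _ _ (measurable_poissonProcess _ s) measurable_id,
    Measure.map_map measurable_sum_range
      ((measurable_poissonProcess _ s).prodMap measurable_id)]
  rfl

/-- The displacement has no atoms outside the origin. -/
lemma displacementLaw_singleton (ha : ∀ x, 0 ≤ a x) (hai : Integrable a) (hd : 0 < d) {s : ℝ}
    (hs : 0 ≤ s) {u : Space d} (hu : u ≠ 0) : displacementLaw a s {u} = 0 := by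
  have := isProbabilityMeasure_jumpLaw ha hai
  have : Nonempty (Fin d) := ⟨⟨0, hd⟩⟩
  have hj : ∀ u : Space d, u ≠ 0 → jumpLaw a {u} = 0 := by
    intro u hu
    unfold jumpLaw
    split_ifs with h
    · rw [Measure.dirac_apply' _ (measurableSet_singleton u)]
      exact Set.indicator_of_notMem (fun h => hu (Set.mem_singleton_iff.1 h).symm) _
    · exact withDensity_absolutelyContinuous _ _ (measure_singleton u)
  have hn : ∀ (n : ℕ) (u : Space d), u ≠ 0 →
      ∀ᵐ ξ ∂(Measure.infinitePi fun _ : ℕ => jumpLaw a), ∑ i ∈ Finset.range n, ξ i ≠ u := by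
    intro n
    induction n with
    | zero => exact fun u hu => .of_forall fun ξ => by simpa using hu.symm
    | succ n ih =>
      intro u hu
      have hm : MeasurableSet {p : Space d × Space d | p.1 + p.2 = u} :=
        measurableSet_eq_fun (by fun_prop) (by fun_prop)
      have h := lintegral_sum_range_eval (jumpLaw a) n (measurable_one.indicator hm)
        (f := {p : Space d × Space d | p.1 + p.2 = u}.indicator 1)
      have hms : MeasurableSet {ξ : ℕ → Space d | ¬ ∑ i ∈ Finset.range (n + 1), ξ i ≠ u} := by
        simp only [not_not]
        exact measurableSet_eq_fun (by fun_prop) (by fun_prop)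
      rw [ae_iff, ← lintegral_indicator_one hms]
      refine Eq.trans (lintegral_congr fun ξ => ?_) (h.trans ?_)
      · simp only [Set.indicator_apply, Set.mem_ofPred_eq, Finset.sum_range_succ, Pi.one_apply,
          not_not]
      · rw [lintegral_eq_zero_iff' (by
          exact ((measurable_one.indicator hm).lintegral_prod_right'.comp
            (f := fun ξ : ℕ → Space d => ∑ i ∈ Finset.range n, ξ i)
            (by fun_prop)).aemeasurable)]
        filter_upwards [ih u hu] with ξ hξ
        have h1 : ∀ y, {p : Space d × Space d | p.1 + p.2 = u}.indicator (1 : Space d × Space d → ENNReal)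
            (∑ i ∈ Finset.range n, ξ i, y) =
            ({u - ∑ i ∈ Finset.range n, ξ i} : Set (Space d)).indicator 1 y := by
          intro y
          simp only [Set.indicator_apply, Set.mem_ofPred_eq, Set.mem_singleton_iff,
            eq_sub_iff_add_eq', Pi.one_apply]
        simp only [h1, lintegral_indicator_one (measurableSet_singleton _)]
        exact hj _ (sub_ne_zero.2 hξ.symm)
  rw [displacementLaw_eq_map_prod ha hai hs,
    Measure.map_apply measurable_sum_range (measurableSet_singleton u),
    Measure.measure_prod_null (measurable_sum_range (measurableSet_singleton u))]
  refine .of_forall fun n => ?_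
  have := hn n u hu
  rw [ae_iff] at this
  simp only [ne_eq, not_not] at this
  exact this

lemma mul_charFun_jumpLaw (ha : ∀ x, 0 ≤ a x) (hai : Integrable a) (k : Space d) :
    (totalRate a : ℂ) * (charFun (jumpLaw a) k - 1) =
      ∫ u, (Complex.exp ((inner ℝ u k : ℝ) * Complex.I) - 1) * a u := by
  have hm : AEStronglyMeasurable (fun u : Space d => Complex.exp ((inner ℝ u k : ℝ) * Complex.I))
      volume := by fun_prop
  have haic : Integrable fun u => (a u : ℂ) := hai.ofReal
  have hi : Integrable fun u : Space d =>
      Complex.exp ((inner ℝ u k : ℝ) * Complex.I) * (a u : ℂ) :=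
    haic.bdd_mul hm (c := 1) (.of_forall fun u => (Complex.norm_exp_ofReal_mul_I _).le)
  have h1 : ∫ u, (Complex.exp ((inner ℝ u k : ℝ) * Complex.I) - 1) * (a u : ℂ) =
      (∫ u, Complex.exp ((inner ℝ u k : ℝ) * Complex.I) * (a u : ℂ)) - totalRate a := by
    simp only [sub_mul, one_mul]
    rw [integral_sub hi haic, integral_complex_ofReal]
    rfl
  rw [h1]
  by_cases h : totalRate a = 0
  · have h0 : a =ᵐ[volume] 0 := (integral_eq_zero_iff_of_nonneg ha hai).1 h
    rw [h, integral_congr_ae (g := fun _ => 0)]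
    · simp
    · filter_upwards [h0] with u hu
      simp [hu]
  · have hr : 0 < totalRate a := (totalRate_nonneg ha).lt_of_ne (Ne.symm h)
    have hc : (totalRate a : ℂ) ≠ 0 := Complex.ofReal_ne_zero.2 h
    rw [charFun_apply, jumpLaw, if_neg h, integral_withDensity_eq_integral_toReal_smul₀
      ((hai.aestronglyMeasurable.aemeasurable.div_const _).ennreal_ofReal)
      (.of_forall fun _ => ENNReal.ofReal_lt_top), mul_sub, mul_one, ← integral_const_mul]
    congr 2
    funext u
    rw [ENNReal.toReal_ofReal (div_nonneg (ha u) hr.le), Complex.real_smul]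
    push_cast
    field_simp

/-- The characteristic function of the displacement. -/
lemma charFun_displacementLaw (ha : ∀ x, 0 ≤ a x) (hai : Integrable a) {s : ℝ} (hs : 0 ≤ s)
    (k : Space d) :
    charFun (displacementLaw a s) k = Complex.exp
      (s * ∫ u, (Complex.exp ((inner ℝ u k : ℝ) * Complex.I) - 1) * a u) := by
  have := isProbabilityMeasure_jumpLaw ha hai
  set J := Measure.infinitePi fun _ : ℕ => jumpLaw a with hJ
  have hpow : ∀ n : ℕ, ∫ ξ, Complex.exp
      ((inner ℝ (∑ i ∈ Finset.range n, ξ i) k : ℝ) * Complex.I) ∂J = charFun (jumpLaw a) k ^ n := by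
    intro n
    have h := ProbabilityTheory.iIndepFun_infinitePi (P := fun _ : ℕ => jumpLaw a)
      (X := fun _ => (id : Space d → Space d)) fun _ => measurable_id
    have h2 := ProbabilityTheory.iIndepFun.charFun_map_fun_finsetSum_eq_prod (s := Finset.range n)
      (X := fun i (ξ : ℕ → Space d) => ξ i) (fun i _ => (measurable_pi_apply i).aemeasurable)
      (h.restrict _)
    have h3 := congrFun h2 k
    rw [charFun_apply, integral_map (by fun_prop) (by fun_prop)] at h3
    rw [hJ, h3, Finset.prod_apply]
    simp only [Measure.infinitePi_map_eval, Finset.prod_const, Finset.card_range]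
  rw [charFun_apply, displacementLaw_eq_map_prod ha hai hs,
    integral_map measurable_sum_range.aemeasurable (by fun_prop), integral_prod]
  · simp only [← hJ, hpow]
    rw [ProbabilityTheory.integral_poissonMeasure,
      Real.coe_toNNReal _ (mul_nonneg (totalRate_nonneg ha) hs),
      ← mul_charFun_jumpLaw ha hai k]
    set c := charFun (jumpLaw a) k
    set r := totalRate a
    have hsum : HasSum (fun n : ℕ => ((r * s : ℝ) * c) ^ n / (n.factorial : ℂ))
        (Complex.exp ((r * s : ℝ) * c)) := by
      rw [Complex.exp_eq_exp_ℂ]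
      exact NormedSpace.expSeries_div_hasSum_exp _
    have h4 := (hsum.mul_left (Complex.exp (-(r * s : ℝ)))).tsum_eq
    rw [← Complex.exp_add] at h4
    refine Eq.trans (tsum_congr fun n => ?_) (h4.trans ?_)
    · rw [Complex.real_smul]
      push_cast
      ring
    · congr 1
      push_cast
      ring
  · refine Integrable.of_bound (C := 1) ?_ (.of_forall fun w =>
      (Complex.norm_exp_ofReal_mul_I _).le)
    have h5 : Measurable fun x : Space d => Complex.exp ((inner ℝ x k : ℝ) * Complex.I) := by
      fun_prop
    exact (h5.comp measurable_sum_range).aestronglyMeasurable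

end Displacement

/-! ### Laplace functionals of Poisson measures -/

section Cutoff

/-- A smooth cutoff function equal to one for `|x| ≤ n + 1` and to zero for `|x| ≥ n + 2`. -/
def cutoff (d n : ℕ) : ContDiffBump (0 : Space d) where
  rIn := n + 1
  rOut := n + 2
  rIn_pos := by positivity
  rIn_lt_rOut := by linarith

variable {d : ℕ}

lemma cutoff_eq_one {n : ℕ} {x : Space d} (hx : ‖x‖ ≤ n + 1) : cutoff d n x = 1 :=
  (cutoff d n).one_of_mem_closedBall (mem_closedBall_zero_iff.2 hx)

lemma cutoff_eq_zero {n : ℕ} {x : Space d} (hx : n + 2 ≤ ‖x‖) : cutoff d n x = 0 :=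
  (cutoff d n).zero_of_le_dist (by rw [dist_zero_right]; exact hx)

lemma contDiff_cutoff (d n : ℕ) : ContDiff ℝ (⊤ : ℕ∞) (cutoff d n) := (cutoff d n).contDiff

lemma tendsto_cutoff (x : Space d) : Tendsto (fun n : ℕ => cutoff d n x) atTop (𝓝 1) := by
  obtain ⟨N, hN⟩ := exists_nat_ge ‖x‖
  refine tendsto_const_nhds.congr' ?_
  filter_upwards [eventually_ge_atTop N] with n hn
  have : (N : ℝ) ≤ n := by exact_mod_cast hn
  exact (cutoff_eq_one (by linarith)).symm

lemma exists_support_ball {f : Space d → ℝ} (hf : HasCompactSupport f) :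
    ∃ N : ℕ, ∀ x, (N : ℝ) < ‖x‖ → f x = 0 := by
  obtain ⟨R, hR⟩ := hf.isCompact.isBounded.subset_closedBall 0
  obtain ⟨n, hn⟩ := exists_nat_ge R
  refine ⟨n, fun x hx => ?_⟩
  by_contra hne
  have := mem_closedBall_zero_iff.1 (hR (subset_tsupport _ hne))
  linarith

end Cutoff

section Poisson

variable {d : ℕ} {z : Space d → ℝ} {π : Measure (Configuration d)} {f g : Space d → ℝ}

instance (γ : Configuration d) : Countable γ.1 := by
  have h : γ.1 = ⋃ n : ℕ, γ.1 ∩ Metric.closedBall 0 (n : ℝ) := by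
    rw [← Set.inter_iUnion, Metric.iUnion_closedBall_nat, Set.inter_univ]
  rw [h]
  exact (Set.countable_iUnion fun n => (γ.2 _ (isCompact_closedBall _ _)).countable).to_subtype

lemma measurable_pairing (hf : Continuous f) (hfc : HasCompactSupport f) :
    Measurable fun γ : Configuration d => pairing f γ :=
  (continuous_pairing ⟨⟨f, hf⟩, hfc⟩).measurable

lemma IsPoisson.laplace_of_contDiff (hπ : IsPoisson z π) (hf : ContDiff ℝ (⊤ : ℕ∞) f)
    (hfc : HasCompactSupport f) :
    ∫ γ, Real.exp (pairing f γ) ∂π = Real.exp (∫ x, (Real.exp (f x) - 1) * z x) :=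
  hπ.laplace ⟨f, hf, hfc, fun _ _ => trivial⟩

lemma IsPoisson.integrable_of_contDiff (hπ : IsPoisson z π) (hf : ContDiff ℝ (⊤ : ℕ∞) f)
    (hfc : HasCompactSupport f) : Integrable (fun γ => Real.exp (pairing f γ)) π := by
  refine .of_integral_ne_zero ?_
  rw [hπ.laplace_of_contDiff hf hfc]
  exact (Real.exp_pos _).ne'

lemma IsPoisson.lintegral_of_contDiff (hπ : IsPoisson z π) (hf : ContDiff ℝ (⊤ : ℕ∞) f)
    (hfc : HasCompactSupport f) :
    ∫⁻ γ, ENNReal.ofReal (Real.exp (pairing f γ)) ∂π =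
      ENNReal.ofReal (Real.exp (∫ x, (Real.exp (f x) - 1) * z x)) := by
  rw [← hπ.laplace_of_contDiff hf hfc, ofReal_integral_eq_lintegral_ofReal
    (hπ.integrable_of_contDiff hf hfc) (.of_forall fun _ => (Real.exp_pos _).le)]

lemma contDiff_cutoff_mul (hf : ContDiff ℝ (⊤ : ℕ∞) f) (n : ℕ) :
    ContDiff ℝ (⊤ : ℕ∞) fun x => cutoff d n x * f x := (contDiff_cutoff d n).mul hf

lemma hasCompactSupport_cutoff_mul (f : Space d → ℝ) (n : ℕ) :
    HasCompactSupport fun x => cutoff d n x * f x := (cutoff d n).hasCompactSupport.mul_right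

lemma tendsto_pairing_cutoff (hfg : ∀ x, |f x| ≤ g x) {γ : Configuration d}
    (hγ : Summable fun x : γ.1 => g x) :
    Tendsto (fun n : ℕ => pairing (fun x => cutoff d n x * f x) γ) atTop (𝓝 (pairing f γ)) := by
  refine tendsto_tsum_of_dominated_convergence hγ (fun x => ?_) (.of_forall fun n x => ?_)
  · simpa using (tendsto_cutoff (x : Space d)).mul_const (f x)
  · rw [Real.norm_eq_abs, abs_mul, abs_of_nonneg (cutoff d n).nonneg]
    exact (mul_le_of_le_one_left (abs_nonneg _) (cutoff d n).le_one).trans (hfg x)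

lemma abs_exp_sub_one_le (y : ℝ) : |Real.exp y - 1| ≤ Real.exp |y| - 1 := by
  rcases le_total 0 y with h | h
  · rw [abs_of_nonneg h, abs_of_nonneg (by linarith [Real.one_le_exp h])]
  · rw [abs_of_nonpos h, abs_of_nonpos (by linarith [Real.exp_le_one_iff.2 h])]
    have h1 := Real.add_one_le_exp y
    have h2 := Real.add_one_le_exp (-y)
    linarith

/-- The exponential moments of `⟨χ g, ·⟩` are bounded uniformly in the cutoff `χ`. -/
lemma IsPoisson.lintegral_cutoff_le (hπ : IsPoisson z π) (hz : ∀ x, 0 ≤ z x) {C : ℝ}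
    (hC : ∀ x, z x ≤ C) (hg : ContDiff ℝ (⊤ : ℕ∞) g) (hg0 : ∀ x, 0 ≤ g x)
    (hgi : Integrable fun x => Real.exp (g x) - 1) (n : ℕ) :
    ∫⁻ γ, ENNReal.ofReal (Real.exp (pairing (fun x => cutoff d n x * g x) γ)) ∂π ≤
      ENNReal.ofReal (Real.exp (∫ x, (Real.exp (g x) - 1) * C)) := by
  rw [hπ.lintegral_of_contDiff (contDiff_cutoff_mul hg n) (hasCompactSupport_cutoff_mul g n)]
  refine ENNReal.ofReal_le_ofReal (Real.exp_le_exp.2 ?_)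
  have h1 : ∀ x, 0 ≤ Real.exp (cutoff d n x * g x) - 1 := fun x =>
    sub_nonneg.2 (Real.one_le_exp (mul_nonneg (cutoff d n).nonneg (hg0 x)))
  refine integral_mono_of_nonneg (.of_forall fun x => mul_nonneg (h1 x) (hz x))
    (hgi.mul_const C) (.of_forall fun x => ?_)
  refine mul_le_mul ?_ (hC x) (hz x) (sub_nonneg.2 (Real.one_le_exp (hg0 x)))
  exact sub_le_sub_right
    (Real.exp_le_exp.2 (mul_le_of_le_one_left (hg0 x) (cutoff d n).le_one)) _

lemma IsPoisson.ae_summable (hπ : IsPoisson z π) (hz : ∀ x, 0 ≤ z x) {C : ℝ}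
    (hC : ∀ x, z x ≤ C) (hg : ContDiff ℝ (⊤ : ℕ∞) g) (hg0 : ∀ x, 0 ≤ g x)
    (hgi : Integrable fun x => Real.exp (g x) - 1) :
    ∀ᵐ γ ∂π, Summable fun x : γ.1 => g x := by
  have hm : ∀ n : ℕ, Measurable fun γ : Configuration d =>
      ENNReal.ofReal (Real.exp (pairing (fun x => cutoff d n x * g x) γ)) := fun n =>
    (Real.measurable_exp.comp (measurable_pairing (contDiff_cutoff_mul hg n).continuous
      (hasCompactSupport_cutoff_mul g n))).ennreal_ofReal
  have hlt : ∫⁻ γ, liminf (fun n : ℕ =>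
      ENNReal.ofReal (Real.exp (pairing (fun x => cutoff d n x * g x) γ))) atTop ∂π ≠ ⊤ := by
    refine ((lintegral_liminf_le hm).trans_lt ?_).ne
    refine lt_of_le_of_lt (liminf_le_of_frequently_le' (.of_forall fun n =>
      hπ.lintegral_cutoff_le hz hC hg hg0 hgi n)) ENNReal.ofReal_lt_top
  filter_upwards [ae_lt_top (.liminf hm) hlt] with γ hγ
  obtain ⟨K, hK1, hK⟩ := exists_between hγ
  have hfr := frequently_lt_of_liminf_lt (by isBoundedDefault) hK1
  refine summable_of_sum_le (c := Real.log K.toReal) (fun x => hg0 x) fun s => ?_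
  have hev : ∀ᶠ n : ℕ in atTop, ∀ x ∈ s, cutoff d n (x : Space d) = 1 := by
    rw [Filter.eventually_all_finset]
    intro x _
    obtain ⟨N, hN⟩ := exists_nat_ge ‖(x : Space d)‖
    filter_upwards [eventually_ge_atTop N] with n hn
    have : (N : ℝ) ≤ n := by exact_mod_cast hn
    exact cutoff_eq_one (by linarith)
  obtain ⟨n, hn1, hn2⟩ := (hfr.and_eventually hev).exists
  have hn3 : Real.exp (pairing (fun x => cutoff d n x * g x) γ) ≤ K.toReal := by
    rw [← ENNReal.ofReal_le_iff_le_toReal hK.ne]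
    exact hn1.le
  have hn4 : ∑ x ∈ s, g x ≤ pairing (fun x => cutoff d n x * g x) γ := by
    have hsum : Summable fun x : γ.1 => cutoff d n (x : Space d) * g x := by
      refine summable_of_hasFiniteSupport ?_
      refine Set.Finite.subset ((γ.2 _ (isCompact_closedBall (0 : Space d)
        (n + 2))).preimage (Subtype.val_injective.injOn (s := _))) fun x hx => ?_
      refine ⟨x.2, mem_closedBall_zero_iff.2 ?_⟩
      by_contra hlt
      exact hx (by
        change cutoff d n (x : Space d) * g x = 0
        rw [cutoff_eq_zero (not_le.1 hlt).le, zero_mul])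
    refine le_trans (Finset.sum_le_sum fun x hx => ?_)
      (hsum.sum_le_tsum s fun x _ => mul_nonneg (cutoff d n).nonneg (hg0 x))
    change g x ≤ cutoff d n (x : Space d) * g x
    rw [hn2 x hx, one_mul]
  rw [Real.le_log_iff_exp_le ((Real.exp_pos _).trans_le hn3)]
  exact (Real.exp_le_exp.2 hn4).trans hn3

lemma IsPoisson.integrable_exp_pairing (hπ : IsPoisson z π) (hz : ∀ x, 0 ≤ z x) {C : ℝ}
    (hC : ∀ x, z x ≤ C) (hg : ContDiff ℝ (⊤ : ℕ∞) g) (hg0 : ∀ x, 0 ≤ g x)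
    (hgi : Integrable fun x => Real.exp (g x) - 1) :
    Integrable (fun γ => Real.exp (pairing g γ)) π := by
  have hm : ∀ n : ℕ, Measurable fun γ : Configuration d =>
      Real.exp (pairing (fun x => cutoff d n x * g x) γ) := fun n =>
    Real.measurable_exp.comp (measurable_pairing (contDiff_cutoff_mul hg n).continuous
      (hasCompactSupport_cutoff_mul g n))
  have hlim : ∀ᵐ γ ∂π, Tendsto (fun n : ℕ =>
      Real.exp (pairing (fun x => cutoff d n x * g x) γ)) atTop
      (𝓝 (Real.exp (pairing g γ))) := by
    filter_upwards [hπ.ae_summable hz hC hg hg0 hgi] with γ hγ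
    exact (Real.continuous_exp.tendsto _).comp
      (tendsto_pairing_cutoff (fun x => (abs_of_nonneg (hg0 x)).le) hγ)
  refine ⟨aestronglyMeasurable_of_tendsto_ae atTop (fun n => (hm n).aestronglyMeasurable) hlim, ?_⟩
  rw [hasFiniteIntegral_iff_ofReal (.of_forall fun _ => (Real.exp_pos _).le)]
  have heq : ∫⁻ γ, ENNReal.ofReal (Real.exp (pairing g γ)) ∂π =
      ∫⁻ γ, liminf (fun n : ℕ =>
        ENNReal.ofReal (Real.exp (pairing (fun x => cutoff d n x * g x) γ))) atTop ∂π := by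
    refine lintegral_congr_ae ?_
    filter_upwards [hlim] with γ hγ
    exact ((ENNReal.continuous_ofReal.tendsto _).comp hγ).liminf_eq.symm
  rw [heq]
  refine (lintegral_liminf_le fun n => (hm n).ennreal_ofReal).trans_lt ?_
  exact lt_of_le_of_lt (liminf_le_of_frequently_le' (.of_forall fun n =>
      hπ.lintegral_cutoff_le hz hC hg hg0 hgi n)) ENNReal.ofReal_lt_top

/-- The Laplace functional of a Poisson measure of bounded intensity, for smooth functions whose
support need not be compact. -/
theorem IsPoisson.laplace_of_abs_le (hπ : IsPoisson z π) (hzm : Measurable z)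
    (hz : ∀ x, 0 ≤ z x) {C : ℝ} (hC : ∀ x, z x ≤ C) (hg : ContDiff ℝ (⊤ : ℕ∞) g)
    (hgi : Integrable fun x => Real.exp (g x) - 1)
    (hf : ContDiff ℝ (⊤ : ℕ∞) f) (hfg : ∀ x, |f x| ≤ g x) :
    Integrable (fun γ => Real.exp (pairing f γ)) π ∧
      ∫ γ, Real.exp (pairing f γ) ∂π = Real.exp (∫ x, (Real.exp (f x) - 1) * z x) := by
  have hg0 : ∀ x, 0 ≤ g x := fun x => (abs_nonneg _).trans (hfg x)
  have hsum := hπ.ae_summable hz hC hg hg0 hgi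
  have hgint := hπ.integrable_exp_pairing hz hC hg hg0 hgi
  have hm : ∀ n : ℕ, Measurable fun γ : Configuration d =>
      Real.exp (pairing (fun x => cutoff d n x * f x) γ) := fun n =>
    Real.measurable_exp.comp (measurable_pairing (contDiff_cutoff_mul hf n).continuous
      (hasCompactSupport_cutoff_mul f n))
  have hcut : ∀ (n : ℕ) (x : Space d), |cutoff d n x * f x| ≤ g x := fun n x => by
    rw [abs_mul, abs_of_nonneg (cutoff d n).nonneg]
    exact (mul_le_of_le_one_left (abs_nonneg _) (cutoff d n).le_one).trans (hfg x)
  have hpair : ∀ {γ : Configuration d}, (Summable fun x : γ.1 => g x) → ∀ {k : Space d → ℝ},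
      (∀ x, |k x| ≤ g x) → pairing k γ ≤ pairing g γ := fun {γ} hγ {k} hk =>
    (Summable.of_norm_bounded hγ fun x => hk x).tsum_le_tsum
      (fun x => (le_abs_self _).trans (hk x)) hγ
  have hlim : ∀ᵐ γ ∂π, Tendsto (fun n : ℕ =>
      Real.exp (pairing (fun x => cutoff d n x * f x) γ)) atTop
      (𝓝 (Real.exp (pairing f γ))) := by
    filter_upwards [hsum] with γ hγ
    exact (Real.continuous_exp.tendsto _).comp (tendsto_pairing_cutoff hfg hγ)
  refine ⟨hgint.mono' (aestronglyMeasurable_of_tendsto_ae atTop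
    (fun n => (hm n).aestronglyMeasurable) hlim) ?_, ?_⟩
  · filter_upwards [hsum] with γ hγ
    rw [Real.norm_eq_abs, Real.abs_exp]
    exact Real.exp_le_exp.2 (hpair hγ hfg)
  · refine tendsto_nhds_unique (tendsto_integral_of_dominated_convergence _
      (fun n => (hm n).aestronglyMeasurable) hgint (fun n => ?_) hlim) ?_
    · filter_upwards [hsum] with γ hγ
      rw [Real.norm_eq_abs, Real.abs_exp]
      exact Real.exp_le_exp.2 (hpair hγ (hcut n))
    · simp only [hπ.laplace_of_contDiff (contDiff_cutoff_mul hf _)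
        (hasCompactSupport_cutoff_mul f _)]
      refine (Real.continuous_exp.tendsto _).comp ?_
      refine tendsto_integral_of_dominated_convergence (fun x => (Real.exp (g x) - 1) * C)
        (fun n => ?_) (hgi.mul_const C) (fun n => .of_forall fun x => ?_) (.of_forall fun x => ?_)
      · have := (contDiff_cutoff_mul hf n).continuous
        exact (((Real.measurable_exp.comp this.measurable).sub_const 1).mul
          hzm).aestronglyMeasurable
      · rw [norm_mul, Real.norm_eq_abs, Real.norm_eq_abs, abs_of_nonneg (hz x)]
        refine mul_le_mul ?_ (hC x) (hz x) (sub_nonneg.2 (Real.one_le_exp (hg0 x)))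
        exact (abs_exp_sub_one_le _).trans (sub_le_sub_right (Real.exp_le_exp.2 (hcut n x)) _)
      · refine Tendsto.mul_const _ (Tendsto.sub_const ?_ _)
        refine (Real.continuous_exp.tendsto _).comp ?_
        simpa using (tendsto_cutoff x).mul_const (f x)

end Poisson

section Admissible

variable {d : ℕ} {z : Space d → ℝ} {π : Measure (Configuration d)}

lemma ncard_le_pairing {f : Space d → ℝ} (hfc : HasCompactSupport f) (hf0 : ∀ x, 0 ≤ f x)
    {r : ℝ} (hf1 : ∀ x, ‖x‖ ≤ r → 1 ≤ f x) (γ : Configuration d) :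
    ((γ.1 ∩ Metric.closedBall 0 r).ncard : ℝ) ≤ pairing f γ := by
  have hB := γ.2 _ (isCompact_closedBall (0 : Space d) r)
  rw [pairing_eq_sum hfc.isCompact (fun x hx => image_eq_zero_of_notMem_tsupport hx),
    Set.ncard_eq_toFinset_card _ hB]
  have hsub : hB.toFinset ⊆ (γ.2 _ hfc.isCompact).toFinset := by
    intro x hx
    rw [Set.Finite.mem_toFinset] at hx ⊢
    refine ⟨hx.1, subset_tsupport _ ?_⟩
    exact (one_pos.trans_le (hf1 x (mem_closedBall_zero_iff.1 hx.2))).ne'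
  refine le_trans ?_ (Finset.sum_le_sum_of_subset_of_nonneg hsub fun x _ _ => hf0 x)
  rw [← nsmul_one]
  refine Finset.card_nsmul_le_sum _ _ _ fun x hx => ?_
  rw [Set.Finite.mem_toFinset] at hx
  exact hf1 x (mem_closedBall_zero_iff.1 hx.2)

/-- Almost every configuration is admissible. -/
theorem IsPoisson.ae_admissible (hd : 0 < d) (hπ : IsPoisson z π) (hz : ∀ x, 0 ≤ z x) {C : ℝ}
    (hC : ∀ x, z x ≤ C) : ∀ᵐ γ ∂π, γ ∈ admissible d := by
  have hC0 : 0 ≤ C := (hz 0).trans (hC 0)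
  have : Nonempty (Fin d) := ⟨⟨0, hd⟩⟩
  set v : ℝ := volume.real (Metric.closedBall (0 : Space d) 1) with hv
  have hv0 : 0 < v :=
    ENNReal.toReal_pos (Metric.measure_closedBall_pos volume _ one_pos).ne'
      (measure_closedBall_lt_top).ne
  have hvol : ∀ r : ℝ, 0 ≤ r → volume.real (Metric.closedBall (0 : Space d) r) = r ^ d * v := by
    intro r hr
    rw [Measure.addHaar_real_closedBall' _ _ hr, finrank_euclideanSpace_fin]
  set ψ : ℕ → Space d → ℝ := fun n x => cutoff d 0 (((n : ℝ) + 1)⁻¹ • x) with hψ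
  have hpos : ∀ n : ℕ, (0 : ℝ) < (n : ℝ) + 1 := fun n => by positivity
  have hnorm : ∀ (n : ℕ) (x : Space d), ‖((n : ℝ) + 1)⁻¹ • x‖ = ‖x‖ / (n + 1) := fun n x => by
    rw [norm_smul, norm_inv, Real.norm_of_nonneg (hpos n).le, inv_mul_eq_div]
  have hψ1 : ∀ (n : ℕ) (x : Space d), ‖x‖ ≤ n + 1 → 1 ≤ ψ n x := by
    intro n x hx
    refine (cutoff_eq_one ?_).ge
    rw [hnorm, div_le_iff₀ (hpos n)]
    simpa using hx
  have hψ2 : ∀ (n : ℕ) (x : Space d), x ∉ Metric.closedBall (0 : Space d) (2 * (n + 1)) →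
      ψ n x = 0 := by
    intro n x hx
    rw [mem_closedBall_zero_iff, not_le] at hx
    refine cutoff_eq_zero ?_
    rw [hnorm, le_div_iff₀ (hpos n)]
    simpa using hx.le
  have hψc : ∀ n, HasCompactSupport (ψ n) := fun n =>
    .intro (isCompact_closedBall _ _) fun x hx => hψ2 n x hx
  have hψs : ∀ n, ContDiff ℝ (⊤ : ℕ∞) (ψ n) := fun n =>
    (contDiff_cutoff d 0).comp (contDiff_const_smul _)
  set w : ℕ → ℝ := fun n => ((n : ℝ) + 1) ^ d * v with hw
  set D : ℝ := 3 * C * 2 ^ d + 1 with hD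
  have hD0 : 0 < D := by positivity
  have hbound : ∀ n, ∫⁻ γ, ENNReal.ofReal (Real.exp (pairing (ψ n) γ - D * w n)) ∂π ≤
      ENNReal.ofReal (Real.exp (-(v * (n + 1)))) := by
    intro n
    have h1 : ∫ x, (Real.exp (ψ n x) - 1) * z x ≤ 3 * C * 2 ^ d * w n := by
      have h2 : ∫ x, (Real.exp (ψ n x) - 1) * z x ≤
          ∫ x, (Metric.closedBall (0 : Space d) (2 * (n + 1))).indicator (fun _ => 3 * C) x := by
        refine integral_mono_of_nonneg (.of_forall fun x => mul_nonneg
          (sub_nonneg.2 (Real.one_le_exp (cutoff d 0).nonneg)) (hz x)) ?_ (.of_forall fun x => ?_)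
        · exact (integrable_indicator_iff measurableSet_closedBall).2
            (integrableOn_const (measure_closedBall_lt_top).ne)
        · by_cases hx : x ∈ Metric.closedBall (0 : Space d) (2 * (n + 1))
          · rw [Set.indicator_of_mem hx]
            refine mul_le_mul ?_ (hC x) (hz x) (by norm_num)
            have h3 : Real.exp (ψ n x) ≤ Real.exp 1 := Real.exp_le_exp.2 (cutoff d 0).le_one
            have h4 := Real.exp_one_lt_d9
            linarith
          · rw [Set.indicator_of_notMem hx]
            simp only [hψ2 n x hx]
            simp
      refine h2.trans_eq ?_
      rw [integral_indicator measurableSet_closedBall, setIntegral_const,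
        hvol _ (by positivity), smul_eq_mul, mul_pow]
      ring
    have h5 : ∀ γ : Configuration d, ENNReal.ofReal (Real.exp (pairing (ψ n) γ - D * w n)) =
        ENNReal.ofReal (Real.exp (pairing (ψ n) γ)) *
          ENNReal.ofReal (Real.exp (-(D * w n))) := fun γ => by
      rw [← ENNReal.ofReal_mul (Real.exp_pos _).le, ← Real.exp_add, sub_eq_add_neg]
    simp only [h5]
    rw [lintegral_mul_const' _ _ ENNReal.ofReal_ne_top,
      hπ.lintegral_of_contDiff (hψs n) (hψc n), ← ENNReal.ofReal_mul (Real.exp_pos _).le,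
      ← Real.exp_add]
    refine ENNReal.ofReal_le_ofReal (Real.exp_le_exp.2 ?_)
    have h6 : ((n : ℝ) + 1) ≤ ((n : ℝ) + 1) ^ d :=
      le_self_pow₀ (by linarith [(Nat.cast_nonneg n : (0 : ℝ) ≤ n)]) hd.ne'
    have h7 : v * (n + 1) ≤ w n := by
      rw [mul_comm]
      exact mul_le_mul_of_nonneg_right h6 hv0.le
    rw [hD]
    linarith
  have hm : ∀ n, Measurable fun γ : Configuration d =>
      ENNReal.ofReal (Real.exp (pairing (ψ n) γ - D * w n)) := fun n =>
    (Real.measurable_exp.comp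
      ((measurable_pairing (hψs n).continuous (hψc n)).sub_const _)).ennreal_ofReal
  have hfin : ∫⁻ γ, ∑' n, ENNReal.ofReal (Real.exp (pairing (ψ n) γ - D * w n)) ∂π ≠ ⊤ := by
    rw [lintegral_tsum fun n => (hm n).aemeasurable]
    refine ((ENNReal.tsum_le_tsum hbound).trans_lt ?_).ne
    have hs : Summable fun n : ℕ => Real.exp (-(v * (n + 1))) := by
      have := (Real.summable_exp_nat_mul_iff (a := -v)).2 (by linarith)
      refine ((summable_nat_add_iff 1).2 this).congr fun n => ?_
      push_cast
      ring_nf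
    exact hs.tsum_ofReal_lt_top
  filter_upwards [ae_lt_top (Measurable.tsum hm) hfin] with γ hγ
  set K := (∑' n, ENNReal.ofReal (Real.exp (pairing (ψ n) γ - D * w n))).toReal with hK
  have hle : ∀ n, Real.exp (pairing (ψ n) γ - D * w n) ≤ K := fun n => by
    rw [hK, ← ENNReal.ofReal_le_iff_le_toReal hγ.ne]
    exact ENNReal.le_tsum n
  have hK0 : 0 < K := (Real.exp_pos _).trans_le (hle 0)
  obtain ⟨m, hm⟩ := exists_nat_ge (D + |Real.log K| / v)
  refine ⟨m, fun n hn => ?_⟩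
  obtain ⟨n, rfl⟩ : ∃ k, n = k + 1 := ⟨n - 1, by omega⟩
  have h1 := (Real.le_log_iff_exp_le hK0).2 (hle n)
  have h2 := ncard_le_pairing (hψc n) (fun x => (cutoff d 0).nonneg) (hψ1 n) γ
  push_cast
  rw [hvol _ (hpos n).le]
  have h3 : v ≤ w n := by
    have : (1 : ℝ) ≤ ((n : ℝ) + 1) ^ d :=
      one_le_pow₀ (by linarith [(Nat.cast_nonneg n : (0 : ℝ) ≤ n)])
    exact le_mul_of_one_le_left hv0.le this
  have h4 : |Real.log K| ≤ |Real.log K| / v * w n := by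
    rw [div_mul_eq_mul_div, le_div_iff₀ hv0]
    exact mul_le_mul_of_nonneg_left h3 (abs_nonneg _)
  have h5 : (D + |Real.log K| / v) * w n ≤ m * w n :=
    mul_le_mul_of_nonneg_right hm (hv0.le.trans h3)
  have h6 := le_abs_self (Real.log K)
  change _ ≤ (m : ℝ) * w n
  linarith

end Admissible

/-! ### Averages over a displaced point -/

section Average

variable {d : ℕ} {φ : Space d → ℝ}

/-- The mean of `φ (x - u)` over `u`. -/
def average (ν : Measure (Space d)) (φ : Space d → ℝ) (x : Space d) : ℝ := ∫ u, φ (x - u) ∂ν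

/-- The cumulant `log ∫ exp (φ (x - u)) ν(du)`. -/
def cumulant (ν : Measure (Space d)) (φ : Space d → ℝ) (x : Space d) : ℝ :=
  Real.log (∫ u, Real.exp (φ (x - u)) ∂ν)

/-- The probability, up to a smooth cutoff, of being near the ball of radius `N`, for a particle started at `x`. -/
def hitting (ν : Measure (Space d)) (N : ℕ) : Space d → ℝ := average ν (cutoff d N)

lemma hitting_nonneg (ν : Measure (Space d)) (N : ℕ) (x : Space d) : 0 ≤ hitting ν N x :=
  integral_nonneg fun _ => (cutoff d N).nonneg

lemma average_eq_convolution (ν : Measure (Space d)) :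
    average ν φ = convolution (fun _ => (1 : ℝ)) φ (ContinuousLinearMap.mul ℝ ℝ) ν := by
  funext x
  simp [average, convolution]

variable (ν : Measure (Space d)) [IsProbabilityMeasure ν]

lemma integrable_of_continuous_hasCompactSupport (hφ : Continuous φ) (hφc : HasCompactSupport φ)
    (x : Space d) : Integrable (fun u => φ (x - u)) ν := by
  obtain ⟨A, hA⟩ := hφ.bounded_above_of_compact_support hφc
  exact .of_bound (by fun_prop : Continuous fun u => φ (x - u)).aestronglyMeasurable A
    (.of_forall fun u => hA _)

lemma contDiff_average (hφ : ContDiff ℝ (⊤ : ℕ∞) φ) (hφc : HasCompactSupport φ) :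
    ContDiff ℝ (⊤ : ℕ∞) (average ν φ) := by
  rw [average_eq_convolution]
  exact hφc.contDiff_convolution_right _ (integrable_const 1).locallyIntegrable hφ

lemma integrable_prod_comp_sub (hφ : Integrable φ) :
    Integrable (fun p : Space d × Space d => φ (p.1 - p.2)) (volume.prod ν) := by
  have := (integrable_const (μ := ν) (1 : ℝ)).convolution_integrand
    (ContinuousLinearMap.mul ℝ ℝ) hφ
  simpa using this

lemma integrable_average (hφ : Integrable φ) : Integrable (average ν φ) :=
  (integrable_prod_comp_sub ν hφ).integral_prod_left

lemma contDiff_hitting (N : ℕ) : ContDiff ℝ (⊤ : ℕ∞) (hitting ν N) :=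
  contDiff_average ν (contDiff_cutoff d N) (cutoff d N).hasCompactSupport

lemma hitting_le_one (N : ℕ) (x : Space d) : hitting ν N x ≤ 1 := by
  have := integral_mono (integrable_of_continuous_hasCompactSupport ν
    (contDiff_cutoff d N).continuous (cutoff d N).hasCompactSupport x) (integrable_const 1)
    fun u => (cutoff d N).le_one (x := x - u)
  rw [integral_const, probReal_univ, one_smul] at this
  exact this

lemma integrable_hitting (N : ℕ) : Integrable (hitting ν N) :=
  integrable_average ν
    ((contDiff_cutoff d N).continuous.integrable_of_hasCompactSupport (cutoff d N).hasCompactSupport)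

lemma exp_sub_one_le_mul_exp {y M : ℝ} (hy : y ≤ M) (hy0 : 0 ≤ y) :
    Real.exp y - 1 ≤ y * Real.exp M := by
  have h1 := Real.add_one_le_exp (-y)
  have h2 : Real.exp (-y) * Real.exp y = 1 := by rw [← Real.exp_add]; simp
  have h3 := Real.exp_pos y
  have h4 := Real.exp_le_exp.2 hy
  nlinarith

lemma integrable_exp_mul_hitting (N : ℕ) {M : ℝ} (hM : 0 ≤ M) :
    Integrable fun x => Real.exp (M * hitting ν N x) - 1 := by
  refine (((integrable_hitting ν N).const_mul M).mul_const (Real.exp M)).mono' ?_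
    (.of_forall fun x => ?_)
  · have := (contDiff_hitting ν N).continuous
    fun_prop
  · have h0 := mul_nonneg hM (hitting_nonneg ν N x)
    rw [Real.norm_of_nonneg (sub_nonneg.2 (Real.one_le_exp h0))]
    exact exp_sub_one_le_mul_exp (mul_le_of_le_one_right hM (hitting_le_one ν N x)) h0

lemma integral_exp_eq (hφ : Continuous φ) (hφc : HasCompactSupport φ) (x : Space d) :
    ∫ u, Real.exp (φ (x - u)) ∂ν = 1 + average ν (fun y => Real.exp (φ y) - 1) x := by
  have h := integrable_of_continuous_hasCompactSupport ν (φ := fun y => Real.exp (φ y) - 1)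
    (by fun_prop) (hφc.comp_left (g := fun y => Real.exp y - 1) (by simp)) x
  have h2 := integral_add (integrable_const (μ := ν) (1 : ℝ)) h
  simp only [add_sub_cancel, integral_const, probReal_univ, smul_eq_mul, mul_one] at h2
  exact h2

lemma integrable_exp_comp_sub (hφ : Continuous φ) (hφc : HasCompactSupport φ) (x : Space d) :
    Integrable (fun u => Real.exp (φ (x - u))) ν := by
  have h := integrable_of_continuous_hasCompactSupport ν (φ := fun y => Real.exp (φ y) - 1)
    (by fun_prop) (hφc.comp_left (g := fun y => Real.exp y - 1) (by simp)) x
  refine (h.add (integrable_const (1 : ℝ))).congr (.of_forall fun u => ?_)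
  simp

lemma integral_exp_comp_sub_pos (hφ : Continuous φ) (hφc : HasCompactSupport φ) (x : Space d) :
    0 < ∫ u, Real.exp (φ (x - u)) ∂ν := by
  exact integral_exp_pos (integrable_exp_comp_sub ν hφ hφc x)

lemma exp_cumulant (hφ : Continuous φ) (hφc : HasCompactSupport φ) (x : Space d) :
    Real.exp (cumulant ν φ x) = ∫ u, Real.exp (φ (x - u)) ∂ν :=
  Real.exp_log (integral_exp_comp_sub_pos ν hφ hφc x)

lemma contDiff_cumulant (hφ : ContDiff ℝ (⊤ : ℕ∞) φ) (hφc : HasCompactSupport φ) :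
    ContDiff ℝ (⊤ : ℕ∞) (cumulant ν φ) := by
  refine ContDiff.log ?_ fun x => (integral_exp_comp_sub_pos ν hφ.continuous hφc x).ne'
  simp only [integral_exp_eq ν hφ.continuous hφc]
  exact contDiff_const.add (contDiff_average ν (hφ.exp.sub contDiff_const)
    (hφc.comp_left (g := fun y => Real.exp y - 1) (by simp)))

lemma abs_cumulant_le (hφ : Continuous φ) (hφc : HasCompactSupport φ) {A : ℝ} (hA : 0 ≤ A)
    (hφA : ∀ x, |φ x| ≤ A) {N : ℕ} (hN : ∀ x, (N : ℝ) < ‖x‖ → φ x = 0) (x : Space d) :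
    |cumulant ν φ x| ≤ A * Real.exp A * hitting ν N x := by
  have hexp := integrable_of_continuous_hasCompactSupport ν (φ := fun y => Real.exp (φ y) - 1)
    (by fun_prop) (hφc.comp_left (g := fun y => Real.exp y - 1) (by simp)) x
  have hint := integrable_of_continuous_hasCompactSupport ν hφ hφc x
  have hcut := integrable_of_continuous_hasCompactSupport ν
    (contDiff_cutoff d N).continuous (cutoff d N).hasCompactSupport x
  have h0 := hitting_nonneg ν N x
  have hone : ∀ y, φ y ≠ 0 → cutoff d N y = 1 := fun y hy => cutoff_eq_one (by
    by_contra h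
    exact hy (hN y (by linarith)))
  rw [abs_le]
  constructor
  · have h1 : ∫ u, -(A * cutoff d N (x - u)) ∂ν ≤ ∫ u, φ (x - u) ∂ν := by
      refine integral_mono (hcut.const_mul A).neg hint fun u => ?_
      by_cases h : φ (x - u) = 0
      · change -(A * cutoff d N (x - u)) ≤ φ (x - u)
        rw [h]
        have := mul_nonneg hA ((cutoff d N).nonneg (x := x - u))
        linarith
      · change -(A * cutoff d N (x - u)) ≤ φ (x - u)
        rw [hone _ h, mul_one]
        exact (abs_le.1 (hφA _)).1
    rw [integral_neg, integral_const_mul] at h1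
    have h2 : ∫ u, φ (x - u) ∂ν ≤ cumulant ν φ x := by
      refine (Real.le_log_iff_exp_le (integral_exp_comp_sub_pos ν hφ hφc x)).2 ?_
      refine convexOn_exp.map_integral_le Real.continuous_exp.continuousOn isClosed_univ
        (.of_forall fun _ => Set.mem_univ _) hint ?_
      exact integrable_exp_comp_sub ν hφ hφc x
    have h3 : A * hitting ν N x ≤ A * Real.exp A * hitting ν N x :=
      mul_le_mul_of_nonneg_right (le_mul_of_one_le_right hA (Real.one_le_exp hA)) h0
    have h4 : ∫ u, cutoff d N (x - u) ∂ν = hitting ν N x := rfl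
    rw [h4] at h1
    linarith
  · have h1 : average ν (fun y => Real.exp (φ y) - 1) x ≤
        ∫ u, A * Real.exp A * cutoff d N (x - u) ∂ν := by
      refine integral_mono hexp (hcut.const_mul _) fun u => ?_
      change Real.exp (φ (x - u)) - 1 ≤ A * Real.exp A * cutoff d N (x - u)
      by_cases h : φ (x - u) = 0
      · rw [h, Real.exp_zero, sub_self]
        have := (cutoff d N).nonneg (x := x - u)
        positivity
      · rw [hone _ h, mul_one]
        have h5 := Real.exp_le_exp.2 (abs_le.1 (hφA (x - u))).2
        have h6 := exp_sub_one_le_mul_exp (le_refl A) hA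
        linarith
    rw [integral_const_mul] at h1
    refine (Real.log_le_sub_one_of_pos (integral_exp_comp_sub_pos ν hφ hφc x)).trans ?_
    rw [integral_exp_eq ν hφ hφc, add_sub_cancel_left]
    exact h1

variable {z : Space d → ℝ} {π : Measure (Configuration d)}

lemma IsPoisson.ae_summable_hitting (hπ : IsPoisson z π) (hz : ∀ x, 0 ≤ z x) {C : ℝ}
    (hC : ∀ x, z x ≤ C) : ∀ᵐ γ ∂π, ∀ N, Summable fun x : γ.1 => hitting ν N x := by
  rw [ae_all_iff]
  intro N
  refine hπ.ae_summable hz hC (contDiff_hitting ν N) (hitting_nonneg ν N) ?_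
  simpa using integrable_exp_mul_hitting ν N zero_le_one

theorem IsPoisson.laplace_cumulant (hπ : IsPoisson z π) (hzm : Measurable z)
    (hz : ∀ x, 0 ≤ z x) {C : ℝ} (hC : ∀ x, z x ≤ C) (hφ : ContDiff ℝ (⊤ : ℕ∞) φ)
    (hφc : HasCompactSupport φ) :
    Integrable (fun γ => Real.exp (pairing (cumulant ν φ) γ)) π ∧
      ∫ γ, Real.exp (pairing (cumulant ν φ) γ) ∂π =
        Real.exp (∫ x, average ν (fun y => Real.exp (φ y) - 1) x * z x) := by
  obtain ⟨A, hA⟩ := hφ.continuous.bounded_above_of_compact_support hφc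
  have hA0 : 0 ≤ A := (norm_nonneg _).trans (hA 0)
  obtain ⟨N, hN⟩ := exists_support_ball hφc
  have h := hπ.laplace_of_abs_le hzm hz hC (contDiff_const.mul (contDiff_hitting ν N))
    (integrable_exp_mul_hitting ν N (by positivity)) (contDiff_cumulant ν hφ hφc)
    (abs_cumulant_le ν hφ.continuous hφc hA0 hA hN)
  refine ⟨h.1, h.2.trans ?_⟩
  simp only [exp_cumulant ν hφ.continuous hφc, integral_exp_eq ν hφ.continuous hφc,
    add_sub_cancel_left]

end Average

/-! ### The particle system started at a fixed configuration -/

section Quenched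

variable {d : ℕ} {a : Space d → ℝ}

lemma map_systemLaw (ha : ∀ x, 0 ≤ a x) (hai : Integrable a) (γ : Configuration d) (s : ℝ)
    (x : γ.1) :
    (systemLaw a γ).map (fun ω => displacement a s (ω x)) = displacementLaw a s := by
  have := isProbabilityMeasure_noiseLaw ha hai
  have h := Measure.map_map (μ := systemLaw a γ) (measurable_displacement a s)
    (measurable_pi_apply (X := fun _ : γ.1 => Noise d) x)
  rw [systemLaw, Measure.infinitePi_map_eval] at h
  exact h.symm

lemma measurable_displacement_eval (γ : Configuration d) (s : ℝ) (x : γ.1) :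
    Measurable fun ω : γ.1 → Noise d => displacement a s (ω x) :=
  (measurable_displacement a s).comp (measurable_pi_apply x)

lemma measurable_particle_eval (γ : Configuration d) (s : ℝ) (x : γ.1) :
    Measurable fun ω : γ.1 → Noise d => particle a x (ω x) s :=
  measurable_const.sub (measurable_displacement_eval γ s x)

/-- Almost surely only finitely many particles meet a given ball. -/
lemma ae_finite_particles (ha : ∀ x, 0 ≤ a x) (hai : Integrable a) {s : ℝ} {γ : Configuration d}
    (hγ : ∀ N, Summable fun x : γ.1 => hitting (displacementLaw a s) N x) :
    ∀ᵐ ω ∂(systemLaw a γ), ∀ N : ℕ, {x : γ.1 | ‖particle a x (ω x) s‖ ≤ N + 1}.Finite := by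
  have := isProbabilityMeasure_displacementLaw ha hai s
  rw [ae_all_iff]
  intro N
  have hle : ∀ x : γ.1, systemLaw a γ {ω | ‖particle a x (ω x) s‖ ≤ N + 1} ≤
      ENNReal.ofReal (hitting (displacementLaw a s) N x) := fun x => ?_
  · have hne : ∑' x : γ.1, systemLaw a γ {ω | ‖particle a x (ω x) s‖ ≤ N + 1} ≠ ⊤ :=
      ((ENNReal.tsum_le_tsum hle).trans_lt (hγ N).tsum_ofReal_lt_top).ne
    filter_upwards [ae_finite_setOfPred_mem hne] with ω hω
    exact hω
  have hB : MeasurableSet {u : Space d | ‖(x : Space d) - u‖ ≤ N + 1} :=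
    measurableSet_le (by fun_prop) measurable_const
  have h1 : systemLaw a γ {ω | ‖particle a x (ω x) s‖ ≤ N + 1} =
      displacementLaw a s {u | ‖(x : Space d) - u‖ ≤ N + 1} := by
    rw [← map_systemLaw ha hai γ s x, Measure.map_apply (measurable_displacement_eval γ s x) hB]
    rfl
  rw [h1, hitting, average, ofReal_integral_eq_lintegral_ofReal
    (integrable_of_continuous_hasCompactSupport _ (contDiff_cutoff d N).continuous
      (cutoff d N).hasCompactSupport x) (.of_forall fun _ => (cutoff d N).nonneg),
    ← lintegral_indicator_one hB]
  refine lintegral_mono fun u => ?_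
  by_cases hu : u ∈ {u : Space d | ‖(x : Space d) - u‖ ≤ N + 1}
  · rw [Set.indicator_of_mem hu, cutoff_eq_one hu]
    simp
  · rw [Set.indicator_of_notMem hu]
    exact zero_le

/-- Almost surely no two particles are at the same place. -/
lemma ae_injective_particles (ha : ∀ x, 0 ≤ a x) (hai : Integrable a) (hd : 0 < d) {s : ℝ}
    (hs : 0 ≤ s) (γ : Configuration d) :
    ∀ᵐ ω ∂(systemLaw a γ), Function.Injective fun x : γ.1 => particle a x (ω x) s := by
  have := isProbabilityMeasure_noiseLaw ha hai
  have := isProbabilityMeasure_displacementLaw ha hai s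
  have key : ∀ x y : γ.1, ∀ᵐ ω ∂(systemLaw a γ),
      particle a x (ω x) s = particle a y (ω y) s → x = y := by
    intro x y
    by_cases hxy : x = y
    · exact .of_forall fun _ _ => hxy
    have hne : (x : Space d) - y ≠ 0 := sub_ne_zero.2 fun h => hxy (Subtype.ext h)
    set ν := displacementLaw a s
    have hmap : (systemLaw a γ).map
        (fun ω => (displacement a s (ω x), displacement a s (ω y))) = ν.prod ν := by
      have h1 := Measure.map_prod_map (noiseLaw a) (noiseLaw a) (measurable_displacement a s)
        (measurable_displacement a s)
      rw [← Measure.infinitePi_map_eval_prod (P := fun _ : γ.1 => noiseLaw a) hxy,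
        Measure.map_map ((measurable_displacement a s).prodMap (measurable_displacement a s))
          (by fun_prop)] at h1
      exact h1.symm
    have hm : MeasurableSet {p : Space d × Space d | (x : Space d) - p.1 = y - p.2} :=
      measurableSet_eq_fun (by fun_prop) (by fun_prop)
    have h0 : (ν.prod ν) {p : Space d × Space d | (x : Space d) - p.1 = y - p.2} = 0 := by
      rw [Measure.measure_prod_null hm]
      have h2 : ∀ᵐ u ∂ν, u ≠ (x : Space d) - y := by
        rw [ae_iff]
        simpa using displacementLaw_singleton ha hai hd hs hne
      filter_upwards [h2] with u hu
      have h3 : Prod.mk u ⁻¹' {p : Space d × Space d | (x : Space d) - p.1 = y - p.2} =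
          {u - (x - y)} := by
        ext v
        simp only [Set.mem_preimage, Set.mem_ofPred_eq, Set.mem_singleton_iff]
        constructor
        · intro h
          rw [sub_eq_sub_iff_add_eq_add] at h
          rw [← sub_eq_zero, ← sub_eq_zero.2 h]
          abel
        · rintro rfl
          abel
      rw [h3]
      exact displacementLaw_singleton ha hai hd hs (sub_ne_zero.2 hu)
    rw [← hmap, Measure.map_apply ((measurable_displacement_eval γ s x).prodMk
      (measurable_displacement_eval γ s y)) hm] at h0
    have h4 : ∀ᵐ ω ∂(systemLaw a γ), ¬ (x : Space d) - displacement a s (ω x) =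
        y - displacement a s (ω y) := by
      rw [ae_iff]
      simpa using h0
    filter_upwards [h4] with ω hω h
    exact absurd h hω
  have h5 : ∀ᵐ ω ∂(systemLaw a γ), ∀ x y : γ.1,
      particle a x (ω x) s = particle a y (ω y) s → x = y := by
    rw [ae_all_iff]
    intro x
    rw [ae_all_iff]
    exact key x
  filter_upwards [h5] with ω hω x y h
  exact hω x y h

lemma pairing_particleSystem {s : ℝ} {γ : Configuration d} {ω : γ.1 → Noise d}
    (hfin : ∀ N : ℕ, {x : γ.1 | ‖particle a x (ω x) s‖ ≤ N + 1}.Finite)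
    (hinj : Function.Injective fun x : γ.1 => particle a x (ω x) s) (φ : Space d → ℝ) :
    pairing φ (particleSystem a γ ω s) = ∑' x : γ.1, φ (particle a x (ω x) s) := by
  have hloc : LocFinite (Set.range fun x : γ.1 => particle a x (ω x) s) := by
    intro K hK
    obtain ⟨R, hR⟩ := hK.isBounded.subset_closedBall 0
    obtain ⟨N, hN⟩ := exists_nat_ge R
    refine ((hfin N).image fun x : γ.1 => particle a x (ω x) s).subset ?_
    rintro _ ⟨⟨x, rfl⟩, hx⟩
    refine ⟨x, ?_, rfl⟩
    have h1 := mem_closedBall_zero_iff.1 (hR hx)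
    change ‖particle a x (ω x) s‖ ≤ N + 1
    linarith
  unfold particleSystem
  rw [dif_pos hloc]
  exact tsum_range φ hinj

lemma lintegral_exp_sum_particles (ha : ∀ x, 0 ≤ a x) (hai : Integrable a) {s : ℝ}
    (γ : Configuration d) {φ : Space d → ℝ} (hφ : Continuous φ) (hφc : HasCompactSupport φ)
    (F : Finset γ.1) :
    ∫⁻ ω, ENNReal.ofReal (Real.exp (∑ x ∈ F, φ (particle a x (ω x) s))) ∂(systemLaw a γ) =
      ENNReal.ofReal (Real.exp (∑ x ∈ F, cumulant (displacementLaw a s) φ x)) := by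
  have := isProbabilityMeasure_noiseLaw ha hai
  have := isProbabilityMeasure_displacementLaw ha hai s
  have hg : ∀ x : γ.1, Measurable fun η : Noise d =>
      ENNReal.ofReal (Real.exp (φ (particle a x η s))) := fun x => by
    have h1 : Measurable fun u : Space d => ENNReal.ofReal (Real.exp (φ (x - u))) := by fun_prop
    exact h1.comp (measurable_displacement a s)
  simp only [Real.exp_sum, ENNReal.ofReal_prod_of_nonneg fun _ _ => (Real.exp_pos _).le]
  refine (ProbabilityTheory.lintegral_prod_eq_prod_lintegral_of_indepFun F
    (fun (x : γ.1) (ω : γ.1 → Noise d) => ENNReal.ofReal (Real.exp (φ (particle a x (ω x) s))))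
    (ProbabilityTheory.iIndepFun_infinitePi (P := fun _ : γ.1 => noiseLaw a)
      (X := fun (x : γ.1) η => ENNReal.ofReal (Real.exp (φ (particle a x η s)))) hg)
    fun x => (hg x).comp (measurable_pi_apply x)).trans ?_
  refine Finset.prod_congr rfl fun x _ => ?_
  have h2 : Measurable fun u : Space d => ENNReal.ofReal (Real.exp (φ (x - u))) := by fun_prop
  rw [exp_cumulant _ hφ hφc, ofReal_integral_eq_lintegral_ofReal
    (integrable_exp_comp_sub _ hφ hφc x) (.of_forall fun _ => (Real.exp_pos _).le),
    ← map_systemLaw ha hai γ s x, lintegral_map h2 (measurable_displacement_eval γ s x)]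
  rfl

lemma summable_comp_particle {s : ℝ} {γ : Configuration d} {ω : γ.1 → Noise d}
    (hfin : ∀ N : ℕ, {x : γ.1 | ‖particle a x (ω x) s‖ ≤ N + 1}.Finite) {φ : Space d → ℝ}
    (hφc : HasCompactSupport φ) : Summable fun x : γ.1 => φ (particle a x (ω x) s) := by
  obtain ⟨N, hN⟩ := exists_support_ball hφc
  refine summable_of_hasFiniteSupport ((hfin N).subset fun x hx => ?_)
  change ‖particle a x (ω x) s‖ ≤ N + 1
  by_contra h
  exact hx (hN _ (by linarith))

lemma summable_cumulant {ν : Measure (Space d)} [IsProbabilityMeasure ν] {γ : Configuration d}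
    (hγ : ∀ N, Summable fun x : γ.1 => hitting ν N x) {φ : Space d → ℝ} (hφ : Continuous φ)
    (hφc : HasCompactSupport φ) : Summable fun x : γ.1 => cumulant ν φ x := by
  obtain ⟨A, hA⟩ := hφ.bounded_above_of_compact_support hφc
  obtain ⟨N, hN⟩ := exists_support_ball hφc
  exact Summable.of_norm_bounded ((hγ N).mul_left (A * Real.exp A)) fun x =>
    abs_cumulant_le ν hφ hφc ((norm_nonneg _).trans (hA 0)) hA hN x

/-- The sums over finite sets of particles converge to the sum over all particles. -/
lemma ae_tendsto_exp_sum (ha : ∀ x, 0 ≤ a x) (hai : Integrable a) {s : ℝ} {γ : Configuration d}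
    (hγ : ∀ N, Summable fun x : γ.1 => hitting (displacementLaw a s) N x) {φ : Space d → ℝ}
    (hφc : HasCompactSupport φ) :
    ∀ᵐ ω ∂(systemLaw a γ), Tendsto
      (fun F : Finset γ.1 => Real.exp (∑ x ∈ F, φ (particle a x (ω x) s))) atTop
      (𝓝 (Real.exp (∑' x : γ.1, φ (particle a x (ω x) s)))) := by
  filter_upwards [ae_finite_particles ha hai hγ] with ω hω
  exact (Real.continuous_exp.tendsto _).comp (summable_comp_particle hω hφc).hasSum

lemma measurable_exp_sum_particles {s : ℝ} {γ : Configuration d} {φ : Space d → ℝ}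
    (hφ : Continuous φ) (F : Finset γ.1) :
    Measurable fun ω : γ.1 → Noise d => Real.exp (∑ x ∈ F, φ (particle a x (ω x) s)) :=
  Real.measurable_exp.comp (Finset.measurable_fun_sum F fun x _ =>
    hφ.measurable.comp (measurable_particle_eval γ s x))

lemma integrable_exp_tsum_particles (ha : ∀ x, 0 ≤ a x) (hai : Integrable a) {s : ℝ}
    {γ : Configuration d}
    (hγ : ∀ N, Summable fun x : γ.1 => hitting (displacementLaw a s) N x) {φ : Space d → ℝ}
    (hφ : Continuous φ) (hφc : HasCompactSupport φ) :
    Integrable (fun ω => Real.exp (∑' x : γ.1, φ (particle a x (ω x) s))) (systemLaw a γ) := by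
  have := isProbabilityMeasure_displacementLaw ha hai s
  have hlim := ae_tendsto_exp_sum ha hai hγ hφc
  refine ⟨aestronglyMeasurable_of_tendsto_ae atTop
    (fun F => (measurable_exp_sum_particles hφ F).aestronglyMeasurable) hlim, ?_⟩
  rw [hasFiniteIntegral_iff_ofReal (.of_forall fun _ => (Real.exp_pos _).le)]
  have heq : ∫⁻ ω, ENNReal.ofReal (Real.exp (∑' x : γ.1, φ (particle a x (ω x) s)))
        ∂(systemLaw a γ) =
      ∫⁻ ω, liminf (fun F : Finset γ.1 =>
        ENNReal.ofReal (Real.exp (∑ x ∈ F, φ (particle a x (ω x) s)))) atTop ∂(systemLaw a γ) := by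
    refine lintegral_congr_ae ?_
    filter_upwards [hlim] with ω hω
    exact ((ENNReal.continuous_ofReal.tendsto _).comp hω).liminf_eq.symm
  rw [heq]
  refine (lintegral_liminf_le fun F =>
    (measurable_exp_sum_particles hφ F).ennreal_ofReal).trans_lt ?_
  simp only [lintegral_exp_sum_particles ha hai γ hφ hφc]
  have h1 : Tendsto (fun F : Finset γ.1 => ENNReal.ofReal
      (Real.exp (∑ x ∈ F, cumulant (displacementLaw a s) φ x))) atTop
      (𝓝 (ENNReal.ofReal (Real.exp (∑' x : γ.1, cumulant (displacementLaw a s) φ x)))) :=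
    ((ENNReal.continuous_ofReal.comp Real.continuous_exp).tendsto _).comp
      (summable_cumulant hγ hφ hφc).hasSum
  rw [h1.liminf_eq]
  exact ENNReal.ofReal_lt_top

/-- The exponential moments of the particle system started at `γ`. -/
theorem laplace_particleSystem (ha : ∀ x, 0 ≤ a x) (hai : Integrable a) (hd : 0 < d) {s : ℝ}
    (hs : 0 ≤ s) {γ : Configuration d}
    (hγ : ∀ N, Summable fun x : γ.1 => hitting (displacementLaw a s) N x) {φ : Space d → ℝ}
    (hφ : Continuous φ) (hφc : HasCompactSupport φ) :
    Integrable (fun ω => Real.exp (pairing φ (particleSystem a γ ω s))) (systemLaw a γ) ∧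
      ∫ ω, Real.exp (pairing φ (particleSystem a γ ω s)) ∂(systemLaw a γ) =
        Real.exp (pairing (cumulant (displacementLaw a s) φ) γ) := by
  have := isProbabilityMeasure_displacementLaw ha hai s
  have hfin := ae_finite_particles ha hai hγ
  have hae : (fun ω => Real.exp (pairing φ (particleSystem a γ ω s))) =ᵐ[systemLaw a γ]
      fun ω => Real.exp (∑' x : γ.1, φ (particle a x (ω x) s)) := by
    filter_upwards [hfin, ae_injective_particles ha hai hd hs γ] with ω h1 h2
    rw [pairing_particleSystem h1 h2]
  refine ⟨(integrable_exp_tsum_particles ha hai hγ hφ hφc).congr hae.symm, ?_⟩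
  rw [integral_congr_ae hae]
  have habs : HasCompactSupport fun x => |φ x| := hφc.comp_left (g := abs) abs_zero
  refine tendsto_nhds_unique (tendsto_integral_filter_of_dominated_convergence _
    (.of_forall fun F => (measurable_exp_sum_particles hφ F).aestronglyMeasurable)
    (.of_forall fun F => ?_) (integrable_exp_tsum_particles ha hai hγ hφ.abs habs)
    (ae_tendsto_exp_sum ha hai hγ hφc)) ?_
  · filter_upwards [hfin] with ω hω
    rw [Real.norm_eq_abs, Real.abs_exp]
    refine Real.exp_le_exp.2 (le_trans (Finset.sum_le_sum fun x _ => le_abs_self _) ?_)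
    exact (summable_comp_particle hω habs).sum_le_tsum F fun x _ => abs_nonneg _
  · have h1 : ∀ F : Finset γ.1,
        ∫ ω, Real.exp (∑ x ∈ F, φ (particle a x (ω x) s)) ∂(systemLaw a γ) =
          Real.exp (∑ x ∈ F, cumulant (displacementLaw a s) φ x) := fun F => by
      rw [integral_eq_lintegral_of_nonneg_ae (.of_forall fun _ => (Real.exp_pos _).le)
        (measurable_exp_sum_particles hφ F).aestronglyMeasurable,
        lintegral_exp_sum_particles ha hai γ hφ hφc, ENNReal.toReal_ofReal (Real.exp_pos _).le]
    simp only [h1]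
    exact (Real.continuous_exp.tendsto _).comp (summable_cumulant hγ hφ hφc).hasSum

end Quenched

/-! ### The annealed Laplace transform -/

section Annealed

variable {d : ℕ} {a z : Space d → ℝ}

lemma locallyIntegrable_of_bounded (hzm : Measurable z) (hz : ∀ x, 0 ≤ z x) {C : ℝ}
    (hC : ∀ x, z x ≤ C) : LocallyIntegrable z :=
  (locallyIntegrable_const C).mono hzm.aestronglyMeasurable (.of_forall fun x => by
    rw [Real.norm_of_nonneg (hz x)]
    exact (hC x).trans (le_abs_self C))

theorem annealed_laplace (hd : 0 < d) (ha : ∀ x, 0 ≤ a x) (hai : Integrable a)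
    (hzm : Measurable z) (hz : ∀ x, 0 ≤ z x) {C : ℝ} (hC : ∀ x, z x ≤ C) (κ : ℕ) {t : ℝ}
    (ht : 0 ≤ t) {φ : Space d → ℝ} (hφ : ContDiff ℝ (⊤ : ℕ∞) φ) (hφc : HasCompactSupport φ)
    {ε : ℝ} (hε : 0 < ε) :
    let μ := (poissonMeasure fun x => z (ε • x)).restrict (admissible d)
    (∀ᵐ γ ∂μ, Integrable (fun ω => Real.exp (scaledField a κ t ε φ γ ω)) (systemLaw a γ)) ∧
      Integrable (quenchedLaplace a κ t ε φ) μ ∧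
      ∫ γ, quenchedLaplace a κ t ε φ γ ∂μ = Real.exp (∫ x,
        average (displacementLaw a (t / ε ^ κ)) (fun y => Real.exp (ε ^ d * φ (ε • y)) - 1) x *
          z (ε • x)) := by
  intro μ
  have hs : 0 ≤ t / ε ^ κ := by positivity
  have := isProbabilityMeasure_displacementLaw ha hai (t / ε ^ κ)
  have hzm' : Measurable fun x => z (ε • x) := hzm.comp (measurable_const_smul ε)
  have hπ : IsPoisson (fun x => z (ε • x)) (poissonMeasure fun x => z (ε • x)) :=
    isPoisson_poissonMeasure hd (fun x => hz _)
      (locallyIntegrable_of_bounded hzm' (fun x => hz _) fun x => hC _)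
  have hμ : μ = poissonMeasure fun x => z (ε • x) :=
    Measure.restrict_eq_self_of_ae_mem (hπ.ae_admissible hd (fun x => hz _) fun x => hC _)
  set ψ : Space d → ℝ := fun y => ε ^ d * φ (ε • y) with hψ
  have hψs : ContDiff ℝ (⊤ : ℕ∞) ψ := contDiff_const.mul (hφ.comp (contDiff_const_smul ε))
  have hψc : HasCompactSupport ψ := (hφc.comp_smul hε.ne').mul_left
  have hfield : ∀ (γ : Configuration d) (ω : γ.1 → Noise d), scaledField a κ t ε φ γ ω =
      pairing ψ (particleSystem a γ ω (t / ε ^ κ)) := fun γ ω => tsum_mul_left.symm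
  have hsum := hπ.ae_summable_hitting (displacementLaw a (t / ε ^ κ)) (fun x => hz _)
    fun x => hC _
  have hq : quenchedLaplace a κ t ε φ =ᵐ[poissonMeasure fun x => z (ε • x)]
      fun γ => Real.exp (pairing (cumulant (displacementLaw a (t / ε ^ κ)) ψ) γ) := by
    filter_upwards [hsum] with γ hγ
    unfold quenchedLaplace
    simp only [hfield]
    exact (laplace_particleSystem ha hai hd hs hγ hψs.continuous hψc).2
  have hL := hπ.laplace_cumulant (displacementLaw a (t / ε ^ κ)) hzm' (fun x => hz _)
    (fun x => hC _) hψs hψc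
  rw [hμ]
  refine ⟨?_, hL.1.congr hq.symm, (integral_congr_ae hq).trans hL.2⟩
  filter_upwards [hsum] with γ hγ
  simp only [hfield]
  exact (laplace_particleSystem ha hai hd hs hγ hψs.continuous hψc).1

end Annealed

/-! ### The hydrodynamic limit -/

section Limit

variable {d : ℕ} {z : Space d → ℝ}

/-- Rescaling of space. -/
lemma integral_average_comp_smul (ν : Measure (Space d)) (f : Space d → ℝ) (hf : Continuous f)
    {ε : ℝ} (hε : 0 < ε) :
    ∫ x, average ν (fun y => f (ε • y)) x * z (ε • x) =
      ∫ y, average (ν.map (ε • ·)) (fun y => (ε ^ d)⁻¹ * f y) y * z y := by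
  have h1 : ∀ x, average ν (fun y => f (ε • y)) x = average (ν.map (ε • ·)) f (ε • x) := by
    intro x
    unfold average
    rw [integral_map (by fun_prop) (by fun_prop)]
    simp only [smul_sub]
  simp only [h1]
  rw [Measure.integral_comp_smul volume (fun y => average (ν.map (ε • ·)) f y * z y) ε,
    finrank_euclideanSpace_fin, abs_of_pos (by positivity), smul_eq_mul, ← integral_const_mul]
  congr 1
  funext y
  unfold average
  rw [integral_const_mul, mul_assoc]

variable (ν : Measure (Space d)) [IsProbabilityMeasure ν]

lemma integral_average {f : Space d → ℝ} (hf : Integrable f) :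
    ∫ x, average ν f x = ∫ x, f x := by
  unfold average
  rw [integral_integral_swap (integrable_prod_comp_sub ν hf)]
  simp [integral_sub_right_eq_self]

lemma integral_average_mul (hzm : Measurable z) (hz : ∀ x, 0 ≤ z x) {C : ℝ}
    (hC : ∀ x, z x ≤ C) {f : Space d → ℝ} (hf : Integrable f) :
    ∫ x, average ν f x * z x = ∫ u, (∫ x, f (x - u) * z x) ∂ν := by
  have hi : Integrable (fun p : Space d × Space d => f (p.1 - p.2) * z p.1)
      (volume.prod ν) :=
    (integrable_prod_comp_sub ν hf).mul_bdd (c := C)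
      (hzm.comp measurable_fst).aestronglyMeasurable
      (.of_forall fun p => by rw [Real.norm_of_nonneg (hz _)]; exact hC _)
  rw [← integral_integral_swap hi]
  congr 1
  funext x
  unfold average
  rw [integral_mul_const]

lemma abs_integral_average_mul_le (hz : ∀ x, 0 ≤ z x) {C : ℝ} (hC : ∀ x, z x ≤ C)
    {f g : Space d → ℝ} (hf : Integrable f) (hg : Integrable g) (hfg : ∀ x, |f x| ≤ g x) :
    |∫ x, average ν f x * z x| ≤ C * ∫ x, g x := by
  have hC0 : 0 ≤ C := (hz 0).trans (hC 0)
  have h1 : ∀ x, |average ν f x| ≤ average ν (fun y => |f y|) x := fun x =>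
    abs_integral_le_integral_abs
  refine (abs_integral_le_integral_abs).trans ?_
  calc ∫ x, |average ν f x * z x| ≤ ∫ x, average ν (fun y => |f y|) x * C := by
        refine integral_mono_of_nonneg (.of_forall fun x => abs_nonneg _)
          ((integrable_average ν hf.abs).mul_const C) (.of_forall fun x => ?_)
        change |average ν f x * z x| ≤ average ν (fun y => |f y|) x * C
        rw [abs_mul, abs_of_nonneg (hz x)]
        exact mul_le_mul (h1 x) (hC x) (hz x) ((abs_nonneg _).trans (h1 x))
    _ = C * ∫ x, |f x| := by rw [integral_mul_const, integral_average ν hf.abs, mul_comm]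
    _ ≤ C * ∫ x, g x := mul_le_mul_of_nonneg_left (integral_mono hf.abs hg hfg) hC0

/-- Weak convergence of the laws of the displaced point gives convergence of the averages. -/
lemma tendsto_integral_average (hzm : Measurable z) (hz : ∀ x, 0 ≤ z x) {C : ℝ}
    (hC : ∀ x, z x ≤ C) {φ : Space d → ℝ} (hφ : Continuous φ) (hφc : HasCompactSupport φ)
    {μ : ℝ → Measure (Space d)} (hμ : ∀ ε, IsProbabilityMeasure (μ ε))
    (h : ∀ k, Tendsto (fun ε => charFun (μ ε) k) (𝓝[>] 0) (𝓝 (charFun ν k))) :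
    Tendsto (fun ε => ∫ x, average (μ ε) φ x * z x) (𝓝[>] 0)
      (𝓝 (∫ x, average ν φ x * z x)) := by
  have hi := hφ.integrable_of_hasCompactSupport (μ := volume) hφc
  set G : Space d → ℝ := fun u => ∫ x, φ (x - u) * z x with hG
  have hGc : Continuous G := by
    have h1 : G = convolution z (fun w => φ (-w)) (ContinuousLinearMap.mul ℝ ℝ) volume := by
      funext u
      simp only [hG, convolution, ContinuousLinearMap.mul_apply', neg_sub, mul_comm]
    rw [h1]
    exact (hφc.comp_homeomorph (Homeomorph.neg (Space d))).continuous_convolution_right _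
      (locallyIntegrable_of_bounded hzm hz hC) (hφ.comp continuous_neg)
  have hGb : ∀ u, ‖G u‖ ≤ C * ∫ x, |φ x| := by
    intro u
    have h1 := abs_integral_average_mul_le (Measure.dirac u) hz hC hi hi.abs fun x => le_rfl
    simpa [average, hG] using h1
  set Gb : BoundedContinuousFunction (Space d) ℝ := .ofNormedAddCommGroup G hGc _ hGb
  have h2 : ∀ (m : Measure (Space d)) [IsProbabilityMeasure m],
      ∫ x, average m φ x * z x = ∫ u, Gb u ∂m := fun m _ =>
    integral_average_mul m hzm hz hC hi
  simp only [h2 _]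
  refine tendsto_of_seq_tendsto fun u hu => ?_
  let P : ℕ → ProbabilityMeasure (Space d) := fun n => ⟨μ (u n), hμ (u n)⟩
  let P₀ : ProbabilityMeasure (Space d) := ⟨ν, inferInstance⟩
  have h3 : Tendsto P atTop (𝓝 P₀) :=
    ProbabilityMeasure.tendsto_of_tendsto_charFun fun k => (h k).comp hu
  exact ProbabilityMeasure.tendsto_iff_forall_integral_tendsto.1 h3 Gb

lemma integrable_average_mul (hzm : Measurable z) (hz : ∀ x, 0 ≤ z x) {C : ℝ}
    (hC : ∀ x, z x ≤ C) {f : Space d → ℝ} (hf : Integrable f) :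
    Integrable fun x => average ν f x * z x :=
  (integrable_average ν hf).mul_bdd (c := C) hzm.aestronglyMeasurable
    (.of_forall fun x => by rw [Real.norm_of_nonneg (hz x)]; exact hC x)

lemma abs_inv_mul_exp_sub_one_sub_le {c y : ℝ} (hc : 0 < c) (hy : |c * y| ≤ 1) :
    |c⁻¹ * (Real.exp (c * y) - 1) - y| ≤ c * y ^ 2 := by
  have h3 : c⁻¹ * (Real.exp (c * y) - 1) - y = c⁻¹ * (Real.exp (c * y) - 1 - c * y) := by
    field_simp
  rw [h3, abs_mul, abs_of_pos (inv_pos.2 hc), inv_mul_le_iff₀ hc]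
  refine (Real.abs_exp_sub_one_sub_id_le hy).trans_eq ?_
  ring

lemma abs_integral_average_exp_sub_le (hzm : Measurable z) (hz : ∀ x, 0 ≤ z x) {C : ℝ}
    (hC : ∀ x, z x ≤ C) {φ : Space d → ℝ} (hφ : Continuous φ) (hφc : HasCompactSupport φ)
    {c : ℝ} (hc : 0 < c) (hcφ : ∀ x, |c * φ x| ≤ 1) :
    |(∫ x, average ν (fun y => c⁻¹ * (Real.exp (c * φ y) - 1)) x * z x) -
      ∫ x, average ν φ x * z x| ≤ c * (C * ∫ x, φ x ^ 2) := by
  have hi := hφ.integrable_of_hasCompactSupport (μ := volume) hφc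
  have hc2 : Continuous fun x => φ x ^ 2 := by fun_prop
  have hcs2 : HasCompactSupport fun x => φ x ^ 2 := by
    simp only [sq]
    exact hφc.mul_left
  have hi2 : Integrable fun x => φ x ^ 2 := hc2.integrable_of_hasCompactSupport hcs2
  set g : Space d → ℝ := fun y => c⁻¹ * (Real.exp (c * φ y) - 1) with hg
  have hgcont : Continuous g := by fun_prop
  have hgc : HasCompactSupport g :=
    hφc.comp_left (g := fun y => c⁻¹ * (Real.exp (c * y) - 1)) (by simp)
  have hgi : Integrable g := hgcont.integrable_of_hasCompactSupport hgc
  have hsub : (∫ x, average ν g x * z x) - ∫ x, average ν φ x * z x =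
      ∫ x, average ν (fun y => g y - φ y) x * z x := by
    rw [← integral_sub (integrable_average_mul ν hzm hz hC hgi)
      (integrable_average_mul ν hzm hz hC hi)]
    refine integral_congr_ae (.of_forall fun x => ?_)
    have h1 : average ν (fun y => g y - φ y) x = average ν g x - average ν φ x :=
      integral_sub (integrable_of_continuous_hasCompactSupport ν hgcont hgc x)
        (integrable_of_continuous_hasCompactSupport ν hφ hφc x)
    simp only [h1, sub_mul]
  rw [hsub]
  refine (abs_integral_average_mul_le ν hz hC (hgi.sub hi) (hi2.const_mul c)
    fun x => abs_inv_mul_exp_sub_one_sub_le hc (hcφ x)).trans_eq ?_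
  rw [integral_const_mul]
  ring

/-- The exponents of the annealed Laplace transforms converge. -/
lemma tendsto_exponent (hd : 0 < d) (hzm : Measurable z) (hz : ∀ x, 0 ≤ z x) {C : ℝ}
    (hC : ∀ x, z x ≤ C) {φ : Space d → ℝ} (hφ : Continuous φ) (hφc : HasCompactSupport φ)
    {μ : ℝ → Measure (Space d)} (hμ : ∀ ε, IsProbabilityMeasure (μ ε))
    (h : ∀ k, Tendsto (fun ε => charFun (μ ε) k) (𝓝[>] 0) (𝓝 (charFun ν k))) :
    Tendsto (fun ε => ∫ x, average (μ ε)
      (fun y => (ε ^ d)⁻¹ * (Real.exp (ε ^ d * φ y) - 1)) x * z x) (𝓝[>] 0)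
      (𝓝 (∫ x, average ν φ x * z x)) := by
  obtain ⟨A, hA⟩ := hφ.bounded_above_of_compact_support hφc
  have hpow : Tendsto (fun ε : ℝ => ε ^ d) (𝓝[>] 0) (𝓝 0) := by
    have h1 : Tendsto (fun ε : ℝ => ε ^ d) (𝓝 0) (𝓝 (0 ^ d)) := (continuous_pow d).tendsto 0
    rw [zero_pow hd.ne'] at h1
    exact h1.mono_left nhdsWithin_le_nhds
  have hlim := tendsto_integral_average ν hzm hz hC hφ hφc hμ h
  have hdiff : Tendsto (fun ε : ℝ => ε ^ d * (C * ∫ x, φ x ^ 2)) (𝓝[>] 0) (𝓝 0) := by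
    simpa using hpow.mul_const (C * ∫ x, φ x ^ 2)
  have hsmall : ∀ᶠ ε : ℝ in 𝓝[>] 0, ε ^ d * A < 1 := by
    have h1 : Tendsto (fun ε : ℝ => ε ^ d * A) (𝓝[>] 0) (𝓝 0) := by simpa using hpow.mul_const A
    exact h1.eventually_lt_const one_pos
  have hclose : Tendsto (fun ε => (∫ x, average (μ ε)
      (fun y => (ε ^ d)⁻¹ * (Real.exp (ε ^ d * φ y) - 1)) x * z x) -
      ∫ x, average (μ ε) φ x * z x) (𝓝[>] 0) (𝓝 0) := by
    refine squeeze_zero_norm' ?_ hdiff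
    filter_upwards [hsmall, self_mem_nhdsWithin] with ε hε hε0
    have hp : 0 < ε ^ d := pow_pos hε0 d
    have hm := hμ ε
    refine abs_integral_average_exp_sub_le (μ ε) hzm hz hC hφ hφc hp fun x => ?_
    rw [abs_mul, abs_of_pos hp]
    exact (mul_le_mul_of_nonneg_left (hA x) hp.le).trans hε.le
  simpa using hclose.add hlim

/-- The mean of `z` over the displaced points, as a distribution. -/
lemma exists_distribution_average (hzm : Measurable z) (hz : ∀ x, 0 ≤ z x) {C : ℝ}
    (hC : ∀ x, z x ≤ C) :
    ∃ ρ : 𝓓'((⊤ : TopologicalSpace.Opens (Space d)), ℝ),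
      ∀ φ : 𝓓((⊤ : TopologicalSpace.Opens (Space d)), ℝ), ρ φ = ∫ x, average ν φ x * z x := by
  set w : Space d → ℝ := fun x => ∫ u, z (x + u) ∂ν with hw
  have hzm2 : Measurable fun p : Space d × Space d => z (p.1 + p.2) := hzm.comp measurable_add
  have hwm : StronglyMeasurable w := hzm2.stronglyMeasurable.integral_prod_right
  have hloc : LocallyIntegrable w := by
    refine (locallyIntegrable_const C).mono hwm.aestronglyMeasurable (.of_forall fun x => ?_)
    refine (norm_integral_le_of_norm_le_const (C := C) (.of_forall fun u => ?_)).trans ?_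
    · rw [Real.norm_of_nonneg (hz _)]
      exact hC _
    · simpa using le_abs_self C
  refine ⟨TestFunction.integralAgainstBilinCLM (ContinuousLinearMap.mul ℝ ℝ) volume w,
    fun φ => ?_⟩
  have hi : Integrable φ := φ.continuous.integrable_of_hasCompactSupport φ.hasCompactSupport
  have h1 := TestFunction.integralAgainstBilinCLM_eq_integral
    (B := ContinuousLinearMap.mul ℝ ℝ) (Ω := (⊤ : TopologicalSpace.Opens (Space d)))
    (hloc.locallyIntegrableOn _) (f := φ)
  refine h1.trans ?_
  simp only [ContinuousLinearMap.mul_apply']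
  have h2 : Integrable (fun p : Space d × Space d => φ p.1 * z (p.1 + p.2)) (volume.prod ν) :=
    (hi.comp_fst ν).mul_bdd (c := C) hzm2.aestronglyMeasurable
      (.of_forall fun p => by rw [Real.norm_of_nonneg (hz _)]; exact hC _)
  rw [integral_average_mul ν hzm hz hC hi]
  simp only [hw, ← integral_const_mul]
  rw [integral_integral_swap (f := fun x u => φ x * z (x + u)) h2]
  refine integral_congr_ae (.of_forall fun u => ?_)
  change ∫ x, φ x * z (x + u) = ∫ x, φ (x - u) * z x
  rw [← integral_sub_right_eq_self (fun x => φ x * z (x + u)) u]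
  simp

variable {a : Space d → ℝ}

/-- If the rescaled displacements converge in law, so do the scaled empirical fields. -/
theorem isHydrodynamicLimit_of_tendsto_charFun (hd : 0 < d) (ha : ∀ x, 0 ≤ a x)
    (hai : Integrable a) (hzm : Measurable z) (hz : ∀ x, 0 ≤ z x) {C : ℝ} (hC : ∀ x, z x ≤ C)
    (κ : ℕ) {t : ℝ} (ht : 0 ≤ t)
    (h : ∀ k, Tendsto (fun ε : ℝ => charFun (displacementLaw a (t / ε ^ κ)) (ε • k)) (𝓝[>] 0)
      (𝓝 (charFun ν k)))
    {ρ : 𝓓'((⊤ : TopologicalSpace.Opens (Space d)), ℝ)}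
    (hρ : ∀ φ : 𝓓((⊤ : TopologicalSpace.Opens (Space d)), ℝ),
      ρ φ = ∫ x, average ν φ x * z x) :
    IsHydrodynamicLimit a z κ t ρ := by
  intro φ
  have hann := fun (ε : ℝ) (hε : 0 < ε) =>
    annealed_laplace hd ha hai hzm hz hC κ ht φ.contDiff φ.hasCompactSupport hε
  refine ⟨fun ε hε => ⟨(hann ε hε).1, (hann ε hε).2.1⟩, ?_⟩
  rw [hρ]
  have hprob : ∀ ε : ℝ, IsProbabilityMeasure ((displacementLaw a (t / ε ^ κ)).map (ε • ·)) :=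
    fun ε => by
      have := isProbabilityMeasure_displacementLaw ha hai (t / ε ^ κ)
      exact Measure.isProbabilityMeasure_map (by fun_prop)
  have hlim := tendsto_exponent ν hd hzm hz hC φ.continuous φ.hasCompactSupport hprob
    (by simpa only [charFun_map_smul] using h)
  refine ((Real.continuous_exp.tendsto _).comp hlim).congr' ?_
  filter_upwards [self_mem_nhdsWithin] with ε hε
  rw [(hann ε hε).2.2]
  have hφ := φ.continuous
  exact congrArg Real.exp (integral_average_comp_smul _
    (fun y => Real.exp (ε ^ d * φ y) - 1) (by fun_prop) hε).symm

end Limit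

/-! ### Moments and characteristic functions -/

section Moments

variable {d : ℕ} {a : Space d → ℝ}

lemma inner_eq_sum (u k : Space d) : inner ℝ u k = ∑ i, u i * k i := by
  rw [PiLp.inner_apply]
  refine Finset.sum_congr rfl fun i _ => ?_
  simp [mul_comm]

lemma integrable_inner_mul (h : ∀ i, Integrable fun x : Space d => x i * a x) (k : Space d) :
    Integrable fun u : Space d => inner ℝ u k * a u := by
  have h1 : (fun u : Space d => inner ℝ u k * a u) = fun u => ∑ i, k i * (u i * a u) := by
    funext u
    rw [inner_eq_sum, Finset.sum_mul]
    exact Finset.sum_congr rfl fun i _ => by ring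
  rw [h1]
  exact integrable_finsetSum _ fun i _ => (h i).const_mul _

lemma integral_inner_mul (h : ∀ i, Integrable fun x : Space d => x i * a x) (k : Space d) :
    ∫ u : Space d, inner ℝ u k * a u = inner ℝ (firstMoment a) k := by
  have h1 : (fun u : Space d => inner ℝ u k * a u) = fun u => ∑ i, k i * (u i * a u) := by
    funext u
    rw [inner_eq_sum, Finset.sum_mul]
    exact Finset.sum_congr rfl fun i _ => by ring
  rw [h1, integral_finsetSum _ fun i _ => (h i).const_mul _, inner_eq_sum]
  refine Finset.sum_congr rfl fun i _ => ?_
  rw [integral_const_mul, mul_comm]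
  rfl

lemma inner_sq_mul_eq (u k : Space d) (c : ℝ) :
    inner ℝ u k ^ 2 * c = ∑ i, ∑ j, k i * k j * (u i * u j * c) := by
  rw [inner_eq_sum, sq, Finset.sum_mul_sum, Finset.sum_mul]
  refine Finset.sum_congr rfl fun i _ => ?_
  rw [Finset.sum_mul]
  exact Finset.sum_congr rfl fun j _ => by ring

lemma integrable_inner_sq_mul (h : ∀ i j, Integrable fun x : Space d => x i * x j * a x)
    (k : Space d) : Integrable fun u : Space d => inner ℝ u k ^ 2 * a u := by
  simp only [inner_sq_mul_eq]
  exact integrable_finsetSum _ fun i _ => integrable_finsetSum _ fun j _ => (h i j).const_mul _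

lemma integral_inner_sq_mul (h : ∀ i j, Integrable fun x : Space d => x i * x j * a x)
    (k : Space d) : ∫ u : Space d, inner ℝ u k ^ 2 * a u = quadForm (secondMoment a) k := by
  simp only [inner_sq_mul_eq]
  rw [integral_finsetSum _ fun i _ => integrable_finsetSum _ fun j _ => (h i j).const_mul _]
  refine Finset.sum_congr rfl fun i _ => ?_
  rw [integral_finsetSum _ fun j _ => (h i j).const_mul _]
  refine Finset.sum_congr rfl fun j _ => ?_
  rw [integral_const_mul, secondMoment, Matrix.of_apply]
  ring

lemma integrable_coord_mul (ha : ∀ x, 0 ≤ a x) (hai : Integrable a)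
    (h : ∀ i j, Integrable fun x : Space d => x i * x j * a x) (i : Fin d) :
    Integrable fun x : Space d => x i * a x := by
  refine (hai.add (h i i)).mono' ?_ (.of_forall fun x => ?_)
  · have : Continuous fun x : Space d => x i := by fun_prop
    exact this.aestronglyMeasurable.mul hai.aestronglyMeasurable
  · change |x i * a x| ≤ a x + x i * x i * a x
    rw [abs_mul, abs_of_nonneg (ha x)]
    have h1 : |x i| ≤ 1 + x i * x i := by
      rw [abs_le]
      constructor <;> nlinarith [sq_nonneg (x i - 1), sq_nonneg (x i + 1)]
    calc |x i| * a x ≤ (1 + x i * x i) * a x := mul_le_mul_of_nonneg_right h1 (ha x)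
      _ = a x + x i * x i * a x := by ring

lemma norm_exp_sub_one_le (x : ℝ) : ‖Complex.exp (x * Complex.I) - 1‖ ≤ |x| := by
  rw [mul_comm]
  exact Real.norm_exp_I_mul_ofReal_sub_one_le

lemma norm_exp_sub_one_sub_le (x : ℝ) :
    ‖Complex.exp (x * Complex.I) - 1 - x * Complex.I‖ ≤ 3 * x ^ 2 := by
  have hn : ‖(x : ℂ) * Complex.I‖ = |x| := by simp
  rcases le_total |x| 1 with h | h
  · have h1 := Complex.norm_exp_sub_sum_le_norm_mul_exp (x * Complex.I) 2
    simp only [Finset.sum_range_succ, Finset.sum_range_zero, hn, sq_abs] at h1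
    have h2 : Real.exp |x| ≤ 3 := by
      have := Real.exp_le_exp.2 h
      have := Real.exp_one_lt_d9
      linarith
    have h3 : Complex.exp (x * Complex.I) - 1 - x * Complex.I = Complex.exp (x * Complex.I) -
        (0 + (x * Complex.I) ^ 0 / (Nat.factorial 0 : ℂ) +
          (x * Complex.I) ^ 1 / (Nat.factorial 1 : ℂ)) := by
      simp
      ring
    rw [h3]
    refine h1.trans ?_
    nlinarith [sq_nonneg x]
  · refine (norm_sub_le _ _).trans ?_
    rw [hn]
    have h1 := norm_exp_sub_one_le x
    rw [← sq_abs]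
    nlinarith

lemma tendsto_exp_sub_one_div (θ : ℝ) :
    Tendsto (fun ε : ℝ => (Complex.exp ((ε * θ : ℝ) * Complex.I) - 1) / ε) (𝓝[>] 0)
      (𝓝 (θ * Complex.I)) := by
  have h1 : HasDerivAt (fun ε : ℝ => Complex.exp ((ε * θ : ℝ) * Complex.I))
      (Complex.exp (((0 : ℝ) * θ : ℝ) * Complex.I) * (θ * Complex.I)) 0 := by
    refine HasDerivAt.cexp ?_
    have h2 : HasDerivAt (fun ε : ℝ => ((ε * θ : ℝ) : ℂ)) ((1 * θ : ℝ) : ℂ) 0 :=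
      ((hasDerivAt_id (0 : ℝ)).mul_const θ).ofReal_comp
    simpa using h2.mul_const Complex.I
  have h3 := h1.tendsto_slope_zero_right
  simp only [zero_add, zero_mul, Complex.ofReal_zero, Complex.exp_zero, one_mul] at h3
  refine h3.congr fun ε => ?_
  rw [Complex.real_smul]
  push_cast
  rw [inv_mul_eq_div]

lemma tendsto_exp_sub_one_sub_div (θ : ℝ) :
    Tendsto (fun ε : ℝ => (Complex.exp ((ε * θ : ℝ) * Complex.I) - 1 - (ε * θ : ℝ) * Complex.I) /
      (ε ^ 2 : ℝ)) (𝓝[>] 0) (𝓝 (-(θ ^ 2 / 2 : ℝ))) := by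
  rw [tendsto_iff_norm_sub_tendsto_zero]
  have hlim : Tendsto (fun ε : ℝ => ε * (|θ| ^ 3 * Real.exp (ε * |θ|))) (𝓝[>] 0) (𝓝 0) := by
    have h1 : Continuous fun ε : ℝ => ε * (|θ| ^ 3 * Real.exp (ε * |θ|)) := by fun_prop
    have h2 := h1.tendsto 0
    rw [zero_mul] at h2
    exact h2.mono_left nhdsWithin_le_nhds
  refine squeeze_zero' (.of_forall fun _ => norm_nonneg _) ?_ hlim
  filter_upwards [self_mem_nhdsWithin] with ε hε
  have hε0 : (0 : ℝ) < ε := hε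
  have hc : ((ε : ℝ) : ℂ) ≠ 0 := Complex.ofReal_ne_zero.2 hε0.ne'
  have hn : ‖((ε * θ : ℝ) : ℂ) * Complex.I‖ = ε * |θ| := by
    simp [abs_of_pos hε0]
  have h1 := Complex.norm_exp_sub_sum_le_norm_mul_exp ((ε * θ : ℝ) * Complex.I) 3
  rw [hn] at h1
  have h3 : (Complex.exp ((ε * θ : ℝ) * Complex.I) - 1 - (ε * θ : ℝ) * Complex.I) /
      (ε ^ 2 : ℝ) - -((θ ^ 2 / 2 : ℝ) : ℂ) = (Complex.exp ((ε * θ : ℝ) * Complex.I) -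
      ∑ m ∈ Finset.range 3, ((ε * θ : ℝ) * Complex.I) ^ m / (m.factorial : ℂ)) /
        (ε ^ 2 : ℝ) := by
    simp only [Finset.sum_range_succ, Finset.sum_range_zero, mul_pow, Complex.I_sq]
    push_cast
    field_simp
    simp
    ring
  rw [h3, norm_div, Complex.norm_real, Real.norm_of_nonneg (by positivity),
    div_le_iff₀ (by positivity)]
  refine h1.trans_eq ?_
  ring

/-- The law of large numbers for the rescaled displacement. -/
lemma tendsto_charFun_of_firstMoment (ha : ∀ x, 0 ≤ a x) (hai : Integrable a)
    (h : ∀ i, Integrable fun x : Space d => x i * a x) {t : ℝ} (ht : 0 ≤ t) (k : Space d) :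
    Tendsto (fun ε : ℝ => charFun (displacementLaw a (t / ε ^ 1)) (ε • k)) (𝓝[>] 0)
      (𝓝 (charFun (Measure.dirac (t • firstMoment a)) k)) := by
  have hlim : Tendsto (fun ε : ℝ => ∫ u : Space d,
      (Complex.exp ((ε * inner ℝ u k : ℝ) * Complex.I) - 1) / ε * a u) (𝓝[>] 0)
      (𝓝 (∫ u : Space d, (inner ℝ u k : ℝ) * Complex.I * a u)) := by
    refine tendsto_integral_filter_of_dominated_convergence
      (fun u : Space d => ‖inner ℝ u k * a u‖) (.of_forall fun ε => ?_) ?_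
      (integrable_inner_mul h k).norm (.of_forall fun u => ?_)
    · have h1 : Continuous fun u : Space d =>
          (Complex.exp ((ε * inner ℝ u k : ℝ) * Complex.I) - 1) / (ε : ℂ) :=
        Continuous.div_const (by fun_prop) _
      exact h1.aestronglyMeasurable.mul hai.ofReal.aestronglyMeasurable
    · filter_upwards [self_mem_nhdsWithin] with ε hε
      have hε0 : (0 : ℝ) < ε := hε
      refine .of_forall fun u => ?_
      rw [norm_mul, norm_div, norm_mul, Complex.norm_real, Complex.norm_real]
      refine mul_le_mul_of_nonneg_right ?_ (norm_nonneg _)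
      rw [Real.norm_of_nonneg hε0.le, div_le_iff₀ hε0]
      refine (norm_exp_sub_one_le _).trans_eq ?_
      rw [abs_mul, abs_of_pos hε0, mul_comm]
      rfl
    · exact (tendsto_exp_sub_one_div _).mul_const _
  have heq : ∫ u : Space d, ((inner ℝ u k : ℝ) : ℂ) * Complex.I * a u =
      (inner ℝ (firstMoment a) k : ℝ) * Complex.I := by
    rw [← integral_inner_mul h k, ← integral_complex_ofReal, ← integral_mul_const]
    congr 1
    funext u
    push_cast
    ring
  rw [charFun_dirac, real_inner_smul_left, Complex.ofReal_mul, mul_assoc, ← heq]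
  refine ((Complex.continuous_exp.tendsto _).comp (hlim.const_mul (t : ℂ))).congr' ?_
  filter_upwards [self_mem_nhdsWithin] with ε hε
  have hε0 : (0 : ℝ) < ε := hε
  rw [charFun_displacementLaw ha hai (by positivity), Function.comp_apply,
    ← integral_const_mul, ← integral_const_mul]
  congr 2
  funext u
  rw [real_inner_smul_right]
  push_cast
  field_simp

/-- The central limit theorem for the rescaled displacement. -/
lemma tendsto_charFun_of_secondMoment (ha : ∀ x, 0 ≤ a x) (hai : Integrable a)
    (h : ∀ i j, Integrable fun x : Space d => x i * x j * a x) (h0 : firstMoment a = 0) {t : ℝ}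
    (ht : 0 ≤ t) (k : Space d) :
    Tendsto (fun ε : ℝ => charFun (displacementLaw a (t / ε ^ 2)) (ε • k)) (𝓝[>] 0)
      (𝓝 (Complex.exp (-(t / 2 * quadForm (secondMoment a) k : ℝ)))) := by
  have hfirst := integrable_coord_mul ha hai h
  have hlim : Tendsto (fun ε : ℝ => ∫ u : Space d,
      (Complex.exp ((ε * inner ℝ u k : ℝ) * Complex.I) - 1 - (ε * inner ℝ u k : ℝ) * Complex.I) /
        (ε ^ 2 : ℝ) * a u) (𝓝[>] 0)
      (𝓝 (∫ u : Space d, -(inner ℝ u k ^ 2 / 2 : ℝ) * (a u : ℂ))) := by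
    refine tendsto_integral_filter_of_dominated_convergence
      (fun u : Space d => 3 * (inner ℝ u k ^ 2 * a u)) (.of_forall fun ε => ?_) ?_
      ((integrable_inner_sq_mul h k).const_mul 3) (.of_forall fun u => ?_)
    · have h1 : Continuous fun u : Space d =>
          (Complex.exp ((ε * inner ℝ u k : ℝ) * Complex.I) - 1 -
            (ε * inner ℝ u k : ℝ) * Complex.I) / ((ε ^ 2 : ℝ) : ℂ) :=
        Continuous.div_const (by fun_prop) _
      exact h1.aestronglyMeasurable.mul hai.ofReal.aestronglyMeasurable
    · filter_upwards [self_mem_nhdsWithin] with ε hε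
      have hε0 : (0 : ℝ) < ε := hε
      refine .of_forall fun u => ?_
      rw [norm_mul, norm_div, Complex.norm_real, Complex.norm_real, Real.norm_of_nonneg (ha u),
        ← mul_assoc]
      refine mul_le_mul_of_nonneg_right ?_ (ha u)
      rw [Real.norm_of_nonneg (by positivity), div_le_iff₀ (by positivity)]
      refine (norm_exp_sub_one_sub_le _).trans_eq ?_
      ring
    · exact (tendsto_exp_sub_one_sub_div _).mul_const _
  have heq : ∫ u : Space d, -((inner ℝ u k ^ 2 / 2 : ℝ) : ℂ) * (a u : ℂ) =
      -(1 / 2 * quadForm (secondMoment a) k : ℝ) := by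
    rw [← integral_inner_sq_mul h k, ← integral_const_mul, ← Complex.ofReal_neg, ← integral_neg,
      ← integral_complex_ofReal]
    congr 1
    funext u
    push_cast
    ring
  have hexp : -((t / 2 * quadForm (secondMoment a) k : ℝ) : ℂ) =
      t * ∫ u : Space d, -((inner ℝ u k ^ 2 / 2 : ℝ) : ℂ) * (a u : ℂ) := by
    rw [heq]
    push_cast
    ring
  rw [hexp]
  refine ((Complex.continuous_exp.tendsto _).comp (hlim.const_mul (t : ℂ))).congr' ?_
  filter_upwards [self_mem_nhdsWithin] with ε hε
  have hε0 : (0 : ℝ) < ε := hε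
  have hc : (ε : ℂ) ≠ 0 := Complex.ofReal_ne_zero.2 hε0.ne'
  have haic : Integrable fun u => (a u : ℂ) := hai.ofReal
  have hi1 : Integrable fun u : Space d =>
      (Complex.exp ((ε * inner ℝ u k : ℝ) * Complex.I) - 1) * (a u : ℂ) := by
    refine haic.bdd_mul (c := 2) (by fun_prop) (.of_forall fun u => ?_)
    refine (norm_sub_le _ _).trans_eq ?_
    rw [Complex.norm_exp_ofReal_mul_I, norm_one]
    norm_num
  have hi2 : Integrable fun u : Space d => ((inner ℝ u k * a u : ℝ) : ℂ) :=
    (integrable_inner_mul hfirst k).ofReal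
  have hz : ∫ u : Space d, ((inner ℝ u k * a u : ℝ) : ℂ) = 0 := by
    rw [integral_complex_ofReal, integral_inner_mul hfirst k, h0, inner_zero_left,
      Complex.ofReal_zero]
  have hsplit : ∫ u : Space d, (Complex.exp ((ε * inner ℝ u k : ℝ) * Complex.I) - 1 -
      (ε * inner ℝ u k : ℝ) * Complex.I) / (ε ^ 2 : ℝ) * a u =
      ((ε ^ 2 : ℝ) : ℂ)⁻¹ * ∫ u : Space d,
        (Complex.exp ((ε * inner ℝ u k : ℝ) * Complex.I) - 1) * (a u : ℂ) := by
    have h1 : ∀ u : Space d, (Complex.exp ((ε * inner ℝ u k : ℝ) * Complex.I) - 1 -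
        (ε * inner ℝ u k : ℝ) * Complex.I) / (ε ^ 2 : ℝ) * a u =
        ((ε ^ 2 : ℝ) : ℂ)⁻¹ * ((Complex.exp ((ε * inner ℝ u k : ℝ) * Complex.I) - 1) * (a u : ℂ)) -
          (ε : ℂ)⁻¹ * Complex.I * ((inner ℝ u k * a u : ℝ) : ℂ) := by
      intro u
      push_cast
      field_simp
    simp only [h1]
    rw [integral_sub (hi1.const_mul _) (hi2.const_mul _), integral_const_mul, integral_const_mul,
      hz, mul_zero, sub_zero]
  rw [charFun_displacementLaw ha hai (by positivity), Function.comp_apply, hsplit, ← mul_assoc]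
  congr 2
  · push_cast
    rw [div_eq_mul_inv]
  · congr 1
    funext u
    rw [real_inner_smul_right]

lemma dotProduct_mulVec_eq_quadForm (M : Matrix (Fin d) (Fin d) ℝ) (k : Fin d → ℝ) :
    k ⬝ᵥ Matrix.mulVec M k = quadForm M (WithLp.toLp 2 k) := by
  unfold quadForm dotProduct Matrix.mulVec dotProduct
  simp only [Finset.mul_sum]
  exact Finset.sum_congr rfl fun i _ => Finset.sum_congr rfl fun j _ => by ring

lemma posSemidef_secondMoment (ha : ∀ x, 0 ≤ a x)
    (h : ∀ i j, Integrable fun x : Space d => x i * x j * a x) :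
    (secondMoment a).PosSemidef := by
  refine .of_dotProduct_mulVec_nonneg ?_ fun k => ?_
  · ext i j
    simp only [secondMoment, Matrix.conjTranspose_apply, Matrix.of_apply, star_trivial]
    congr 1
    funext x
    ring
  · rw [star_trivial, dotProduct_mulVec_eq_quadForm, ← integral_inner_sq_mul h]
    exact integral_nonneg fun u => mul_nonneg (sq_nonneg _) (ha u)

lemma charFun_gaussian (ha : ∀ x, 0 ≤ a x)
    (h : ∀ i j, Integrable fun x : Space d => x i * x j * a x) {t : ℝ} (ht : 0 ≤ t)
    (k : Space d) :
    charFun (ProbabilityTheory.multivariateGaussian 0 (t • secondMoment a)) k =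
      Complex.exp (-(t / 2 * quadForm (secondMoment a) k : ℝ)) := by
  rw [ProbabilityTheory.charFun_multivariateGaussian ((posSemidef_secondMoment ha h).smul ht),
    inner_zero_right, Matrix.smul_mulVec, dotProduct_smul, dotProduct_mulVec_eq_quadForm]
  congr 1
  simp only [smul_eq_mul]
  push_cast
  ring

end Moments

/-! ### Fourier inversion -/

section Fourier

open FourierTransform

variable {d : ℕ}

lemma fourierTr_eq (f : Space d → ℂ) (k : Space d) :
    fourierTr f k = (((2 * Real.pi) ^ (-(d : ℝ) / 2) : ℝ) : ℂ) *
      𝓕 f ((2 * Real.pi)⁻¹ • k) := by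
  unfold fourierTr
  rw [Real.fourier_eq']
  congr 2
  funext x
  rw [smul_eq_mul, real_inner_smul_right]
  congr 2
  have : Real.pi ≠ 0 := Real.pi_ne_zero
  have h1 : -2 * Real.pi * ((2 * Real.pi)⁻¹ * inner ℝ x k) = -inner ℝ x k := by
    field_simp
  rw [h1]
  push_cast
  ring

variable {φ : Space d → ℝ}

lemma integrable_fourier_ofReal (hφ : ContDiff ℝ (⊤ : ℕ∞) φ) (hφc : HasCompactSupport φ) :
    Integrable (𝓕 fun y => (φ y : ℂ)) := by
  have hc : HasCompactSupport fun y => (φ y : ℂ) := hφc.comp_left Complex.ofReal_zero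
  have hs : ContDiff ℝ (⊤ : ℕ∞) fun y => (φ y : ℂ) := Complex.ofRealCLM.contDiff.comp hφ
  have h := (𝓕 (hc.toSchwartzMap hs)).integrable (μ := volume)
  rw [SchwartzMap.fourier_coe] at h
  exact h

lemma integrable_fourierTr (hφ : ContDiff ℝ (⊤ : ℕ∞) φ) (hφc : HasCompactSupport φ) :
    Integrable (fourierTr fun y => (φ y : ℂ)) := by
  have h1 : (fourierTr fun y => (φ y : ℂ)) = fun k =>
      (((2 * Real.pi) ^ (-(d : ℝ) / 2) : ℝ) : ℂ) *
        𝓕 (fun y => (φ y : ℂ)) ((2 * Real.pi)⁻¹ • k) := funext (fourierTr_eq _)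
  rw [h1]
  exact ((integrable_fourier_ofReal hφ hφc).comp_smul (by positivity)).const_mul _

lemma fourierTr_inversion (hφ : ContDiff ℝ (⊤ : ℕ∞) φ) (hφc : HasCompactSupport φ)
    (y : Space d) :
    (((2 * Real.pi) ^ (-(d : ℝ) / 2) : ℝ) : ℂ) *
      ∫ k, Complex.exp (Complex.I * (inner ℝ k y : ℝ)) * fourierTr (fun y => (φ y : ℂ)) k =
        φ y := by
  have hcont : Continuous fun y => (φ y : ℂ) := Complex.continuous_ofReal.comp hφ.continuous
  have hc : HasCompactSupport fun y => (φ y : ℂ) := hφc.comp_left Complex.ofReal_zero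
  have hinv := congrFun (hcont.fourierInv_fourier_eq (hcont.integrable_of_hasCompactSupport hc)
    (integrable_fourier_ofReal hφ hφc)) y
  rw [Real.fourierInv_eq'] at hinv
  set H : Space d → ℂ := fun w =>
    Complex.exp ((2 * Real.pi * inner ℝ w y : ℝ) * Complex.I) • 𝓕 (fun y => (φ y : ℂ)) w with hH
  have h1 : ∀ k : Space d, Complex.exp (Complex.I * (inner ℝ k y : ℝ)) *
      fourierTr (fun y => (φ y : ℂ)) k =
        (((2 * Real.pi) ^ (-(d : ℝ) / 2) : ℝ) : ℂ) * H ((2 * Real.pi)⁻¹ • k) := by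
    intro k
    rw [fourierTr_eq]
    have h2 : 2 * Real.pi * inner ℝ ((2 * Real.pi)⁻¹ • k) y = inner ℝ k y := by
      rw [real_inner_smul_left]
      have : Real.pi ≠ 0 := Real.pi_ne_zero
      field_simp
    simp only [hH, h2, smul_eq_mul]
    rw [mul_comm Complex.I]
    ring
  simp only [h1]
  rw [integral_const_mul, Measure.integral_comp_smul volume H, hinv, finrank_euclideanSpace_fin,
    ← mul_assoc, ← Complex.ofReal_mul, ← Real.rpow_add (by positivity), Complex.real_smul,
    ← mul_assoc, ← Complex.ofReal_mul]
  have h3 : (2 * Real.pi) ^ (-(d : ℝ) / 2 + -(d : ℝ) / 2) * |((2 * Real.pi)⁻¹ ^ d)⁻¹| = 1 := by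
    rw [add_halves, abs_of_pos (by positivity), inv_pow, inv_inv, Real.rpow_neg (by positivity),
      Real.rpow_natCast, inv_mul_cancel₀ (by positivity)]
  rw [h3, Complex.ofReal_one, one_mul]

lemma average_dirac (φ : Space d → ℝ) (v x : Space d) :
    average (Measure.dirac v) φ x = φ (x - v) :=
  integral_dirac _ _

/-- The Fourier representation of the average of a test function. -/
lemma average_eq_fourier (ν : Measure (Space d)) [IsProbabilityMeasure ν]
    (hφ : ContDiff ℝ (⊤ : ℕ∞) φ) (hφc : HasCompactSupport φ) (x : Space d) :
    (((2 * Real.pi) ^ (-(d : ℝ) / 2) : ℝ) : ℂ) *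
      ∫ k, Complex.exp (Complex.I * (inner ℝ k x : ℝ)) * charFun ν (-k) *
        fourierTr (fun y => (φ y : ℂ)) k = average ν φ x := by
  set c : ℂ := (((2 * Real.pi) ^ (-(d : ℝ) / 2) : ℝ) : ℂ)
  have hF := integrable_fourierTr hφ hφc
  have h1 : ∀ k : Space d, Complex.exp (Complex.I * (inner ℝ k x : ℝ)) * charFun ν (-k) *
      fourierTr (fun y => (φ y : ℂ)) k = ∫ v, Complex.exp (Complex.I * (inner ℝ k (x - v) : ℝ)) *
        fourierTr (fun y => (φ y : ℂ)) k ∂ν := by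
    intro k
    rw [integral_mul_const, charFun_apply, ← integral_const_mul]
    congr 2
    funext v
    rw [← Complex.exp_add, inner_sub_right, inner_neg_right, real_inner_comm k v]
    congr 1
    push_cast
    ring
  simp only [h1]
  have h2 : Integrable (Function.uncurry fun (k v : Space d) =>
      Complex.exp (Complex.I * (inner ℝ k (x - v) : ℝ)) * fourierTr (fun y => (φ y : ℂ)) k)
      (volume.prod ν) := by
    refine (hF.comp_fst ν).bdd_mul (c := 1)
      (f := fun p : Space d × Space d => Complex.exp (Complex.I * (inner ℝ p.1 (x - p.2) : ℝ)))
      (by fun_prop) (.of_forall fun p => ?_)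
    rw [mul_comm]
    exact (Complex.norm_exp_ofReal_mul_I _).le
  rw [integral_integral_swap h2, ← integral_const_mul]
  simp only [c, fourierTr_inversion hφ hφc]
  rw [integral_complex_ofReal]
  rfl

end Fourier

end FreeKawasaki

end

theorem mainTheorem3 {d : ℕ} (hd : 1 ≤ d)
    (a : Space d → ℝ) (ha_nonneg : ∀ x, 0 ≤ a x) (ha_int : Integrable a)
    (z : Space d → ℝ) (hz_meas : Measurable z) (hz_nonneg : ∀ x, 0 ≤ z x)
    (hz_bdd : ∃ C : ℝ, ∀ x, z x ≤ C) (hz_fourier : FourierIsSignedMeasure z)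
    (t : ℝ) (ht : 0 ≤ t) :
    ((∀ i, Integrable fun x : Space d => x i * a x) → firstMoment a ≠ 0 →
      ∃ ρ : 𝓓'((⊤ : TopologicalSpace.Opens (Space d)), ℝ),
        (∀ φ : 𝓓((⊤ : TopologicalSpace.Opens (Space d)), ℝ),
          ρ φ = ∫ x, z (x + t • firstMoment a) * φ x) ∧
        IsHydrodynamicLimit a z 1 t ρ) ∧
    ((∀ i j, Integrable fun x : Space d => x i * x j * a x) → firstMoment a = 0 →
      ∃ ρ : 𝓓'((⊤ : TopologicalSpace.Opens (Space d)), ℝ),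
        (∀ φ : 𝓓((⊤ : TopologicalSpace.Opens (Space d)), ℝ),
          ((ρ φ : ℝ) : ℂ) = (((2 * Real.pi) ^ (-(d : ℝ) / 2) : ℝ) : ℂ) *
            ∫ x, (z x : ℂ) * ∫ k, Complex.exp (Complex.I * (inner ℝ k x : ℝ)) *
              Complex.exp (-(t / 2 * quadForm (secondMoment a) k : ℝ)) *
              fourierTr (fun y => (φ y : ℂ)) k) ∧
        IsHydrodynamicLimit a z 2 t ρ) := by
  obtain ⟨C, hC⟩ := hz_bdd
  refine ⟨fun hmom _ => ?_, fun hmom hzero => ?_⟩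
  · obtain ⟨ρ, hρ⟩ := exists_distribution_average (Measure.dirac (t • firstMoment a)) hz_meas
      hz_nonneg hC
    refine ⟨ρ, fun φ => ?_, isHydrodynamicLimit_of_tendsto_charFun _ hd ha_nonneg ha_int hz_meas
      hz_nonneg hC 1 ht (tendsto_charFun_of_firstMoment ha_nonneg ha_int hmom ht) hρ⟩
    rw [hρ, ← integral_sub_right_eq_self
      (fun x => z (x + t • firstMoment a) * φ x) (t • firstMoment a)]
    congr 1
    funext x
    rw [average_dirac, sub_add_cancel, mul_comm]
  · have hchar := charFun_gaussian ha_nonneg hmom ht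
    obtain ⟨ρ, hρ⟩ := exists_distribution_average
      (ProbabilityTheory.multivariateGaussian 0 (t • secondMoment a)) hz_meas hz_nonneg hC
    refine ⟨ρ, fun φ => ?_, isHydrodynamicLimit_of_tendsto_charFun _ hd ha_nonneg ha_int hz_meas
      hz_nonneg hC 2 ht (fun k => ?_) hρ⟩
    · rw [hρ, ← integral_complex_ofReal, ← integral_const_mul]
      congr 1
      funext x
      have hneg : ∀ k : Space d, Complex.exp (-(t / 2 * quadForm (secondMoment a) k : ℝ)) =
          charFun (ProbabilityTheory.multivariateGaussian 0 (t • secondMoment a)) (-k) := by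
        intro k
        rw [hchar]
        simp [quadForm]
      simp only [hneg]
      rw [mul_left_comm, average_eq_fourier _ φ.contDiff φ.hasCompactSupport]
      push_cast
      ring
    · rw [hchar]
      exact tendsto_charFun_of_secondMoment ha_nonneg ha_int hmom hzero ht k
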